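/- Let $n \ge 2$ be an integer and let $G$ be an abelian group with $G \simeq C_2 \oplus C_2 \oplus C_{2n}$, where $C_m$ denotes a cyclic group of order $m$; thus $\exp(G) = 2n$. A sequence over $G$ is a finite unordered sequence of elements of $G$ with repetition allowed, i.e. an element of the (multiplicatively written) free abelian monoid $\mathcal{F}(G)$ over $G$; its subsequences are its divisors, its length is the number of its terms counted with multiplicity, $\sigma(S)$ denotes the sum of its terms, $\operatorname{supp}(S)$ the set of its terms, and $h+S$ the sequence obtained by adding $h \in G$ to each term. A sequence is zero-sum if its sum is $0$. Let $\mathsf{s}(G)$ be the smallest $\ell$ such that every sequence over $G$ of length at least $\ell$ has a zero-sum subsequence of length $\exp(G)$. A basis of $G$ is an independent generating set, where $f_1,f_2,f_3$ are independent if $a_1f_1+a_2f_2+a_3f_3=0$ with integers $a_i$ implies $a_if_i=0$ for each $i$. Intervals $[x,y]$ are intervals of integers. Then $\mathsf{s}(G) - 1 = 4n+2$, and a sequence $S$ over $G$ of length $|S| = \mathsf{s}(G)-1 = 4n+2$ contains no zero-sum subsequence of length $\exp(G) = 2n$ if and only if there exist a basis $\{f_1,f_2,f_3\}$ of $G$,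 where $\operatorname{ord}(f_1)=\operatorname{ord}(f_2)=2$ and $\operatorname{ord}(f_3)=2n$, and an $f \in G$ such that $-f+S$ is equal to one of the following sequences: (s1) $0^{2\alpha+1} f_2^{2n-2\alpha-1} f_3^{2n-1-2\beta} (f_3+f_2)^{2\beta+1} (af_3+f_1)\bigl((1-a)f_3+f_2+f_1\bigr)$ with $a \in [2,n-1]$ and $\alpha,\beta \in [0,n-1]$; (s2) $0^{2n-1} f_3^{2n-1} (af_3+f_2)\bigl((1-a)f_3+f_2\bigr)(bf_3+f_1)\bigl((1-b)f_3+f_1\bigr)$ with $a,b \in [2,n-1]$ and $a \ge b$; (s3) $0^{2\alpha+1} f_1^{2\beta+1} f_2^{2\gamma+1} \prod_{i=1}^{2n+1}(f_3+d_i)$, where $\alpha,\beta,\gamma \in [0,n-1]$ are such that $\alpha+\beta+\gamma = n-1$, and $S' = \prod_{i=1}^{2n+1} d_i$ is a sequence over $\langle f_1,f_2\rangle$ with $\sigma(S') \notin \operatorname{supp}(S')$. -/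

import Mathlib

namespace EGZ

section Sequences

variable {G : Type*} [AddCommGroup G]

/-- A sequence over `G` (an element of the free abelian monoid over `G`) is a multiset of elements
of `G`; the product of sequences is the sum of multisets and a subsequence is a submultiset.
`subsums L S` is the set `Σ_L(S)` of the sums of the nonempty subsequences of `S` whose length
lies in `L`. -/
def subsums (L : Set ℕ) (S : Multiset G) : Set G :=
  {x | ∃ T : Multiset G, T ≤ S ∧ T ≠ 0 ∧ T.card ∈ L ∧ T.sum = x}

variable (G) in
/-- `s_L(G)`: the smallest `ℓ` such that every sequence over `G` of length at least `ℓ` has a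
nonempty zero-sum subsequence with length in `L`; it is `⊤` when there is no such `ℓ`. -/
noncomputable def zeroSumConstant (L : Set ℕ) : ℕ∞ :=
  sInf ((fun ℓ : ℕ => (ℓ : ℕ∞)) ''
    {ℓ : ℕ | ∀ S : Multiset G, ℓ ≤ S.card → (0 : G) ∈ subsums L S})

variable (G) in
/-- The Erdős–Ginzburg–Ziv constant `s(G)`. -/
noncomputable def egzConstant : ℕ∞ :=
  zeroSumConstant G {AddMonoid.exponent G}

/-- The translate `h + S`. -/
def translate (h : G) (S : Multiset G) : Multiset G :=
  S.map (fun g => h + g)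

/-- `f₁, f₂, f₃` are independent: `a₁ f₁ + a₂ f₂ + a₃ f₃ = 0` with integers `aᵢ` implies that
every `aᵢ fᵢ` is `0`. -/
def Independent (f₁ f₂ f₃ : G) : Prop :=
  ∀ a₁ a₂ a₃ : ℤ, a₁ • f₁ + a₂ • f₂ + a₃ • f₃ = 0 →
    a₁ • f₁ = 0 ∧ a₂ • f₂ = 0 ∧ a₃ • f₃ = 0

/-- `f₁, f₂, f₃` form a basis of `G` (an independent generating set) and have orders
`2, 2, 2n`. -/
def IsBasis (n : ℕ) (f₁ f₂ f₃ : G) : Prop :=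
  Independent f₁ f₂ f₃ ∧ AddSubgroup.closure {f₁, f₂, f₃} = (⊤ : AddSubgroup G) ∧
    addOrderOf f₁ = 2 ∧ addOrderOf f₂ = 2 ∧ addOrderOf f₃ = 2 * n

/-- The form
`0^(2α+1) f₂^(2n-2α-1) f₃^(2n-1-2β) (f₃+f₂)^(2β+1) (a f₃+f₁) ((1-a) f₃+f₂+f₁)`. The natural
number subtractions do not truncate, as `α, β ≤ n - 1` and `1 ≤ n` where the form is used. -/
def FormS1 (n : ℕ) (f₁ f₂ f₃ : G) (T : Multiset G) : Prop :=
  ∃ α β : ℕ, ∃ a : ℤ, α ≤ n - 1 ∧ β ≤ n - 1 ∧ 2 ≤ a ∧ a ≤ (n : ℤ) - 1 ∧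
    T = Multiset.replicate (2 * α + 1) 0 + Multiset.replicate (2 * n - 2 * α - 1) f₂
      + Multiset.replicate (2 * n - 1 - 2 * β) f₃ + Multiset.replicate (2 * β + 1) (f₃ + f₂)
      + {a • f₃ + f₁} + {(1 - a) • f₃ + f₂ + f₁}

/-- The form `0^(2n-1) f₃^(2n-1) (a f₃+f₂) ((1-a) f₃+f₂) (b f₃+f₁) ((1-b) f₃+f₁)`. -/
def FormS2 (n : ℕ) (f₁ f₂ f₃ : G) (T : Multiset G) : Prop :=
  ∃ a b : ℤ, 2 ≤ a ∧ a ≤ (n : ℤ) - 1 ∧ 2 ≤ b ∧ b ≤ (n : ℤ) - 1 ∧ b ≤ a ∧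
    T = Multiset.replicate (2 * n - 1) 0 + Multiset.replicate (2 * n - 1) f₃
      + {a • f₃ + f₂} + {(1 - a) • f₃ + f₂} + {b • f₃ + f₁} + {(1 - b) • f₃ + f₁}

/-- The form `0^(2α+1) f₁^(2β+1) f₂^(2γ+1) ∏ (f₃ + dᵢ)`, where `D = ∏ dᵢ` is a sequence of length
`2n+1` over `⟨f₁, f₂⟩` whose sum is not one of its terms. -/
def FormS3 (n : ℕ) (f₁ f₂ f₃ : G) (T : Multiset G) : Prop :=
  ∃ α β γ : ℕ, ∃ D : Multiset G, α ≤ n - 1 ∧ β ≤ n - 1 ∧ γ ≤ n - 1 ∧ α + β + γ = n - 1 ∧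
    D.card = 2 * n + 1 ∧ (∀ d ∈ D, d ∈ AddSubgroup.closure {f₁, f₂}) ∧ D.sum ∉ D ∧
    T = Multiset.replicate (2 * α + 1) 0 + Multiset.replicate (2 * β + 1) f₁
      + Multiset.replicate (2 * γ + 1) f₂ + D.map (fun d => f₃ + d)

end Sequences

end EGZ

/-! Let `π : G → G/2G ≅ C₂³`; its kernel `2G` is cyclic of order `n`. Pair off terms of `S` lying in
the same fibre of `π` until the unpaired terms `U` lie in distinct fibres. Pair sums lie in `ker π`,
and `n` of them with sum zero would give a zero-sum subsequence of length `2n`. By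
Erdős–Ginzburg–Ziv there are hence at most `2n - 2` pairs. As `|U| ≤ 8` and `|S| = 4n + 2`, either
`2n - 3` pairs and eight unpaired terms occur, or `2n - 2` pairs and six unpaired terms. Call four
terms of `U` whose sum lies in `ker π` a plane. A plane together with `n - 2` pairs has length `2n`,
so minus the plane sum is not a sum of `n - 2` pair sums. The inverse theorem for cyclic groups then
says that any `2n - 3` of the pair sums form `a^(n-1) b^(n-2)` and that every plane has sum `a + b`
(`exists_pairSums_eq`). So all planes have equal sums; exchanging a paired term with an unpaired one
in the same fibre shows, where enough planes exist, that the two are equal (`eq_of_mem_entries`).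
With eight fibres, adding up the planes through a point forces `a = b`, a contradiction. With six
fibres, the unpaired terms form three couples `sᵢ, tᵢ` with common sum `r`, all terms of `S` are
among these six, and half of the paired part, when doubled, becomes `a^(n-1) b^(n-1)` with `2r = a +
b` (`SixFibres.structure_eq`). A couple whose doubles are not `a` and `b` occurs only once. The
number of couples with doubles `a, b` is three, two or one, which gives the forms (s3), (s1), (s2)
respectively. A sequence of length `4n + 3` is excluded by parity: deleting any term must leave an
odd number of terms in each occupied fibre. The converse compares coordinates in the basis. -/

namespace EGZ

/-! ### The Kemperman–Scherk bound for sumsets. -/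

section Scherk

open scoped Pointwise
open Finset

variable {A : Type*} [AddCommGroup A] [DecidableEq A]

/-- The Kemperman–Scherk theorem: if `0 = 0 + 0` is the only representation of `0` in `X + Y`,
then `|X| + |Y| - 1 ≤ |X + Y|`. -/
theorem card_add_card_le_of_unique_zero (X Y : Finset A) (hX : (0 : A) ∈ X) (hY : (0 : A) ∈ Y)
    (h : ∀ x ∈ X, ∀ y ∈ Y, x + y = 0 → y = 0) : #X + #Y ≤ #(X + Y) + 1 := by
  induction hk : #Y using Nat.strong_induction_on generalizing X Y with
  | _ k ih =>
  by_cases hc : ∀ e ∈ X, ∀ y ∈ Y, e + y ∈ X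
  · have hsub : Y ⊆ {0} := by
      intro y hy
      -- Translation by `y` maps the finite set `X` into itself, hence permutes it, so `0 = e + y`
      -- for some `e ∈ X`.
      have hinj : (X.image (· + y)) = X := by
        apply Finset.eq_of_subset_of_card_le
        · intro z hz
          obtain ⟨e, he, rfl⟩ := Finset.mem_image.1 hz
          exact hc e he y hy
        · rw [Finset.card_image_of_injective _ (add_left_injective y)]
      have : (0 : A) ∈ X.image (· + y) := by rw [hinj]; exact hX
      obtain ⟨e, he, hey⟩ := Finset.mem_image.1 this
      exact Finset.mem_singleton.2 (h e he y hy hey)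
    have h1 : #Y ≤ 1 := by simpa using Finset.card_le_card hsub
    have h2 : #X ≤ #(X + Y) := Finset.card_le_card (Finset.subset_add_left X hY)
    omega
  · push Not at hc
    obtain ⟨e, he, y, hy, hey⟩ := hc
    -- The Dyson `e`-transform: it keeps `|X| + |Y|`, does not enlarge the sumset, and shrinks `Y`
    -- because `e + y ∉ X`. Uniqueness of `0 = 0 + 0` survives: a new relation `(e + b) + w = 0`
    -- with `e + w ∈ X` gives first `b = 0` and then `w = 0`.
    set X' := X ∪ Y.image (e + ·) with hX'
    set Y' := Y.filter (fun z => e + z ∈ X) with hY'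
    have hlt : #Y' < #Y := Finset.card_lt_card
      (Finset.filter_ssubset.2 ⟨y, hy, hey⟩)
    have hsub : X' + Y' ⊆ X + Y := by
      intro z hz
      obtain ⟨x, hx, w, hw, rfl⟩ := Finset.mem_add.1 hz
      rw [hY', Finset.mem_filter] at hw
      rcases Finset.mem_union.1 hx with hx | hx
      · exact Finset.add_mem_add hx hw.1
      · obtain ⟨b, hb, rfl⟩ := Finset.mem_image.1 hx
        rw [show e + b + w = (e + w) + b by abel]
        exact Finset.add_mem_add hw.2 hb
    have hcard : #X' + #Y' = #X + #Y := by
      have h1 : Y'.image (e + ·) = X ∩ Y.image (e + ·) := by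
        ext z
        simp only [hY', Finset.mem_image, Finset.mem_filter, Finset.mem_inter]
        constructor
        · rintro ⟨a, ⟨ha, hb⟩, rfl⟩
          exact ⟨hb, a, ha, rfl⟩
        · rintro ⟨hz, a, ha, rfl⟩
          exact ⟨a, ⟨ha, hz⟩, rfl⟩
      have h2 := Finset.card_union_add_card_inter X (Y.image (e + ·))
      rw [← h1, Finset.card_image_of_injective _ (add_right_injective e),
        Finset.card_image_of_injective _ (add_right_injective e)] at h2
      exact h2
    have h3 := ih #Y' (by omega) X' Y' (Finset.mem_union_left _ hX)
      (by simp [hY', hY, he]) (by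
        intro x hx w hw hxw
        rw [hY', Finset.mem_filter] at hw
        rcases Finset.mem_union.1 hx with hx | hx
        · exact h x hx w hw.1 hxw
        · obtain ⟨b, hb, rfl⟩ := Finset.mem_image.1 hx
          have hb0 := h (e + w) hw.2 b hb (by rw [← hxw]; abel)
          subst hb0
          exact h e he w hw.1 (by simpa using hxw)) rfl
    have h4 := Finset.card_le_card hsub
    omega

end Scherk

/-! ### Sequences without short zero-sum subsequences. -/

section ShortSums

open scoped Pointwise
open Finset

theorem sub_dedup_add {B : Type*} [DecidableEq B] (W : Multiset B) : W - W.dedup + W.dedup = W :=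
  tsub_add_cancel_of_le (Multiset.dedup_le W)

theorem count_sub_dedup_le {B : Type*} [DecidableEq B] {W : Multiset B} {k : ℕ}
    (h : ∀ b, W.count b ≤ k + 1) (a : B) :
    (W - W.dedup).count a ≤ k := by
  have := h a
  rw [Multiset.count_sub, Multiset.count_dedup]
  split_ifs with ha
  · omega
  · rw [Multiset.count_eq_zero_of_notMem ha]; omega

variable {A : Type*} [AddCommGroup A] [DecidableEq A]

/-- A sequence with multiplicities at most `k` and without short zero-sums has many short
subsums. -/
theorem exists_short_sums (k : ℕ) (W : Multiset A) (hk : ∀ a, W.count a ≤ k)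
    (h0 : ∀ Z ≤ W, Z.card ≤ k → Z.sum = 0 → Z = 0) :
    ∃ X : Finset A, 0 ∈ X ∧ W.card + 1 ≤ #X ∧ ∀ x ∈ X, ∃ Z ≤ W, Z.card ≤ k ∧ Z.sum = x := by
  induction k generalizing W with
  | zero =>
    have : W = 0 := by
      refine Multiset.eq_zero_of_forall_notMem fun a ha => ?_
      have := Multiset.count_pos.2 ha
      have := hk a
      omega
    subst this
    exact ⟨{0}, by simp, by simp, by simp⟩
  | succ k ih =>
    have hle : W - W.dedup ≤ W := tsub_le_self
    -- Peel off one copy of each distinct term. This layer adds at most one term to a short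
    -- subsequence, and by Kemperman–Scherk it enlarges the set of short sums by its number of
    -- terms.
    obtain ⟨X, hX0, hXc, hX⟩ := ih (W - W.dedup) (count_sub_dedup_le hk)
      (fun Z hZ hZk hZs => h0 Z (hZ.trans hle) (by omega) hZs)
    have hn0 : (0 : A) ∉ W.toFinset := by
      intro h
      have := h0 {0} (by simpa using h) (by simp) (by simp)
      simp at this
    refine ⟨X + insert 0 W.toFinset, ?_, ?_, ?_⟩
    · exact Finset.mem_add.2 ⟨0, hX0, 0, by simp, by simp⟩
    · have hs := card_add_card_le_of_unique_zero X (insert 0 W.toFinset) hX0 (by simp) (by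
        intro x hx y hy hxy
        rcases Finset.mem_insert.1 hy with rfl | hy
        · rfl
        exfalso
        obtain ⟨Z, hZ, hZk, rfl⟩ := hX x hx
        have := h0 (Z + {y}) (by
          calc Z + {y} ≤ (W - W.dedup) + W.dedup :=
                add_le_add hZ (by simpa using hy)
            _ = W := sub_dedup_add W) (by simpa using hZk) (by simpa using hxy)
        simp at this)
      rw [Finset.card_insert_of_notMem hn0] at hs
      have h1 : (W - W.dedup).card + W.dedup.card = W.card := by
        rw [← Multiset.card_add, sub_dedup_add]
      have h2 : #W.toFinset = W.dedup.card := rfl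
      omega
    · intro x hx
      obtain ⟨u, hu, v, hv, rfl⟩ := Finset.mem_add.1 hx
      obtain ⟨Z, hZ, hZk, rfl⟩ := hX u hu
      rcases Finset.mem_insert.1 hv with rfl | hv
      · exact ⟨Z, hZ.trans hle, by omega, by simp⟩
      · refine ⟨Z + {v}, ?_, by simpa using hZk, by simp⟩
        calc Z + {v} ≤ (W - W.dedup) + W.dedup := add_le_add hZ (by simpa using hv)
          _ = W := sub_dedup_add W

theorem card_lt_of_no_short_zero_sum [Finite A] (k : ℕ) (W : Multiset A)
    (hk : ∀ a, W.count a ≤ k) (h0 : ∀ Z ≤ W, Z.card ≤ k → Z.sum = 0 → Z = 0) :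
    W.card + 1 ≤ Nat.card A := by
  obtain ⟨X, -, hX, -⟩ := exists_short_sums k W hk h0
  have : Fintype A := Fintype.ofFinite A
  rw [Nat.card_eq_fintype_card]
  exact hX.trans (Finset.card_le_univ X)

/-- If a finite set `K` of nonzero elements contains all sums of two distinct elements of `K`, and
`K` has at least two elements, then `K = -K`. -/
theorem neg_mem_of_add_mem (K : Finset A) {g h : A} (hg : g ∈ K) (hh : h ∈ K) (hgh : g ≠ h)
    (h0 : (0 : A) ∉ K) (hK : ∀ x ∈ K, ∀ y ∈ K, x ≠ y → x + y ∈ K) : -g ∈ K := by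
  -- Translation by `x` permutes `K \ {x}`, so subtraction of `x` stays in `K`. Then `-g = (h - g) -
  -- h`.
  have key : ∀ x ∈ K, ∀ y ∈ K, y ≠ x → y - x ∈ K := by
    intro x hx y hy hyx
    have him : (K.erase x).image (· + x) = K.erase x := by
      apply Finset.eq_of_subset_of_card_le
      · intro z hz
        obtain ⟨w, hw, rfl⟩ := Finset.mem_image.1 hz
        rw [Finset.mem_erase] at hw ⊢
        refine ⟨fun hw0 => h0 ?_, hK w hw.2 x hx hw.1⟩
        have : w = 0 := by simpa using hw0
        exact this ▸ hw.2
      · rw [Finset.card_image_of_injective _ (add_left_injective x)]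
    have hy' : y ∈ (K.erase x).image (· + x) := by
      rw [him]; exact Finset.mem_erase.2 ⟨hyx, hy⟩
    obtain ⟨w, hw, hwx⟩ := Finset.mem_image.1 hy'
    have : y - x = w := by rw [← hwx]; simp
    rw [this]
    exact (Finset.mem_erase.1 hw).2
  have h1 := key g hg h hh hgh.symm
  have hg0 : g ≠ 0 := fun h => h0 (h ▸ hg)
  have h2 := key h hh (h - g) h1 (by simpa using hg0)
  simpa using h2

/-- A strengthening of `card_lt_of_no_short_zero_sum` for sequences with two distinct terms. -/
theorem card_add_two_le_of_no_short_zero_sum [Finite A] (k : ℕ) (W : Multiset A)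
    (hk : ∀ a, W.count a ≤ k + 1) (h0 : ∀ Z ≤ W, Z.card ≤ k + 2 → Z.sum = 0 → Z = 0)
    {g h : A} (hg : g ∈ W) (hh : h ∈ W) (hgh : g ≠ h) (hg2 : g + g ≠ 0) :
    W.card + 2 ≤ Nat.card A := by
  have hle : W - W.dedup ≤ W := tsub_le_self
  obtain ⟨X, hX0, hXc, hX⟩ := exists_short_sums k (W - W.dedup) (count_sub_dedup_le hk)
      (fun Z hZ hZk hZs => h0 Z (hZ.trans hle) (by omega) hZs)
  set K := W.toFinset with hKdef
  have hn0 : (0 : A) ∉ K := by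
    intro h
    have := h0 {0} (by simpa [hKdef] using h) (by simp) (by simp)
    simp at this
  have hpair : ∀ x ∈ K, ∀ y ∈ K, x ≠ y → ({x, y} : Multiset A) ≤ W.dedup := by
    intro x hx y hy hxy
    rw [Multiset.le_iff_subset (by simp [hxy])]
    intro z hz
    have : z = x ∨ z = y := by simpa using hz
    rcases this with rfl | rfl
    · simpa [hKdef] using hx
    · simpa [hKdef] using hy
  have hpair0 : ∀ x ∈ K, ∀ y ∈ K, x ≠ y → x + y ≠ 0 := by
    intro x hx y hy hxy hs
    have := h0 {x, y} ((hpair x hx y hy hxy).trans (Multiset.dedup_le W)) (by simp)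
      (by simpa using hs)
    simp at this
  -- If the support is closed under sums of distinct elements, it contains `g` and `-g ≠ g`, a
  -- zero-sum of length two. Otherwise some `x + y` is new, and allowing two terms from the last
  -- layer gains one further sum; this is why lengths up to `k + 2` are needed.
  by_cases hc : ∀ x ∈ K, ∀ y ∈ K, x ≠ y → x + y ∈ K
  · exfalso
    have hgK : g ∈ K := by simpa [hKdef] using hg
    have := neg_mem_of_add_mem K hgK (by simpa [hKdef] using hh) hgh hn0 hc
    refine hpair0 g hgK (-g) this ?_ (by simp)
    intro h
    apply hg2
    nth_rewrite 2 [h]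
    simp
  · push Not at hc
    obtain ⟨x, hx, y, hy, hxy, hs⟩ := hc
    set Y := insert 0 (K.erase x) + {0, x} with hY
    have hYc : #K + 2 ≤ #Y := by
      have h1 : insert (x + y) (insert 0 K) ⊆ Y := by
        intro z hz
        simp only [Finset.mem_insert] at hz
        rw [hY, Finset.mem_add]
        rcases hz with rfl | rfl | hz
        · exact ⟨y, by simp [hxy.symm, hy], x, by simp, add_comm _ _⟩
        · exact ⟨0, by simp, 0, by simp, by simp⟩
        · by_cases hzx : z = x
          · exact ⟨0, by simp, x, by simp, by simp [hzx]⟩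
          · exact ⟨z, by simp [hzx, hz], 0, by simp, by simp⟩
      have h2 := Finset.card_le_card h1
      rwa [Finset.card_insert_of_notMem (by
        simp only [Finset.mem_insert, not_or]
        exact ⟨hpair0 x hx y hy hxy, hs⟩), Finset.card_insert_of_notMem hn0] at h2
    have hrep : ∀ z ∈ Y, z = 0 ∨ ∃ Z ≤ W.dedup, Z ≠ 0 ∧ Z.card ≤ 2 ∧ Z.sum = z := by
      intro z hz
      rw [hY, Finset.mem_add] at hz
      obtain ⟨u, hu, v, hv, rfl⟩ := hz
      rw [Finset.mem_insert, Finset.mem_erase] at hu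
      have hv' : v = 0 ∨ v = x := by simpa using hv
      rcases hu with rfl | ⟨hux, hu⟩ <;> rcases hv' with rfl | rfl
      · simp
      · right
        exact ⟨{v}, by simpa [hKdef] using hx, by simp, by simp, by simp⟩
      · right
        exact ⟨{u}, by simpa [hKdef] using hu, by simp, by simp, by simp⟩
      · right
        exact ⟨{u, v}, hpair u hu v hx hux, by simp, by simp, by simp⟩
    have hs := card_add_card_le_of_unique_zero X Y hX0 (by
        rw [hY, Finset.mem_add]; exact ⟨0, by simp, 0, by simp, by simp⟩) (by
      intro u hu v hv huv
      rcases hrep v hv with h | ⟨Z, hZ, hZ0, hZ2, rfl⟩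
      · exact h
      exfalso
      obtain ⟨Z', hZ', hZk, rfl⟩ := hX u hu
      have := h0 (Z' + Z) (by
          calc Z' + Z ≤ (W - W.dedup) + W.dedup := add_le_add hZ' hZ
            _ = W := sub_dedup_add W) (by rw [Multiset.card_add]; omega) (by simpa using huv)
      exact hZ0 (by simpa using (add_eq_zero.1 this).2))
    have h1 : (W - W.dedup).card + W.dedup.card = W.card := by
      rw [← Multiset.card_add, sub_dedup_add]
    have h2 : #K = W.dedup.card := rfl
    have : Fintype A := Fintype.ofFinite A
    have h3 := Finset.card_le_univ (X + Y)
    rw [Nat.card_eq_fintype_card]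
    omega

end ShortSums

/-! ### The inverse Erdős–Ginzburg–Ziv theorem in cyclic groups. -/

section Cyclic

/-- The multiplicities `n - 1` and `n - 2` tell the two values apart. For `n = 2` the value `b` does
not occur at all and is recovered only as the other element of a two-element set, whence the
condition on `Nat.card B`. -/
theorem replicate_add_replicate_unique {B : Type*} {n : ℕ} (hn : 2 ≤ n) {a b a' b' : B} (hab : a ≠ b)
    (hab' : a' ≠ b') (hA : Nat.card B = n)
    (h : Multiset.replicate (n - 1) a + Multiset.replicate (n - 2) b =
      Multiset.replicate (n - 1) a' + Multiset.replicate (n - 2) b') : a = a' ∧ b = b' := by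
  classical
  have ha : a = a' := by
    by_contra hne
    have h1 := congrArg (Multiset.count a) h
    simp only [Multiset.count_add, Multiset.count_replicate] at h1
    rw [if_pos trivial, if_neg hab.symm, if_neg (Ne.symm hne)] at h1
    split_ifs at h1 <;> omega
  subst ha
  refine ⟨rfl, ?_⟩
  have h2 := add_left_cancel h
  rcases Nat.lt_or_ge 2 n with h3 | h3
  · exact Multiset.replicate_right_injective (by omega) h2
  · have h4 : Nat.card B = 2 := by omega
    obtain ⟨x, y, hxy, hu⟩ := Nat.card_eq_two_iff.1 h4
    have hall : ∀ z : B, z = x ∨ z = y := fun z => by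
      have : z ∈ ({x, y} : Set B) := hu ▸ Set.mem_univ z
      simpa using this
    rcases hall a with rfl | rfl <;> rcases hall b with rfl | rfl <;>
      rcases hall b' with rfl | rfl <;> simp_all

variable {A : Type*} [AddCommGroup A]

theorem sum_map_add_const (T : Multiset A) (a : A) :
    (T.map (· + a)).sum = T.sum + T.card • a := by
  simp [Multiset.sum_map_add]

/-- In a finite cyclic group there is at most one element of order two. -/
theorem eq_of_add_self_eq_zero [Finite A] [IsAddCyclic A] {x y : A} (hx : x ≠ 0) (hy : y ≠ 0)
    (hx2 : x + x = 0) (hy2 : y + y = 0) : x = y := by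
  classical
  have : Fintype A := Fintype.ofFinite A
  by_contra hxy
  have h1 := IsAddCyclic.card_nsmul_eq_zero_le (α := A) (n := 2) (by norm_num)
  have h2 : ({0, x, y} : Finset A) ⊆ Finset.univ.filter (fun a : A => 2 • a = 0) := by
    intro z hz
    simp only [Finset.mem_insert, Finset.mem_singleton] at hz
    rcases hz with rfl | rfl | rfl <;> simp [two_nsmul, *]
  have h3 := Finset.card_le_card h2
  rw [Finset.card_insert_of_notMem (by simp [hx.symm, hy.symm]),
    Finset.card_pair hxy] at h3
  omega

theorem exists_zero_sum_of_card_ge [Finite A] [IsAddCyclic A] (T : Multiset A)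
    (hT : 2 * Nat.card A - 1 ≤ T.card) : ∃ Z ≤ T, Z.card = Nat.card A ∧ Z.sum = 0 := by
  classical
  let e : ZMod (Nat.card A) ≃+ A := zmodAddCyclicAddEquiv inferInstance
  obtain ⟨Z, hZ, hZc, hZs⟩ := ZMod.erdos_ginzburg_ziv_multiset (T.map e.symm) (by simpa using hT)
  refine ⟨Z.map e, ?_, by simpa using hZc, ?_⟩
  · simpa using Multiset.map_le_map (f := e) hZ
  · rw [← map_multiset_sum, hZs, map_zero]

theorem exists_longest_zero_sum (W : Multiset A) (n : ℕ) :
    ∃ Z ≤ W, Z.card ≤ n ∧ Z.sum = 0 ∧ ∀ Y ≤ W, Y.card ≤ n → Y.sum = 0 → Y.card ≤ Z.card := by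
  classical
  obtain ⟨Z, hZ, hmax⟩ := Finset.exists_max_image
    (W.powerset.toFinset.filter fun Z => Z.card ≤ n ∧ Z.sum = 0) Multiset.card ⟨0, by simp⟩
  simp only [Finset.mem_filter, Multiset.mem_toFinset, Multiset.mem_powerset] at hZ hmax
  exact ⟨Z, hZ.1, hZ.2.1, hZ.2.2, fun Y h1 h2 h3 => hmax Y ⟨h1, h2, h3⟩⟩

/-- The inverse Erdős–Ginzburg–Ziv theorem for cyclic groups, for a sequence in which `0` has
maximal multiplicity. -/
theorem eq_replicate_of_no_zero_sum_of_max [DecidableEq A] [Finite A] [IsAddCyclic A]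
    (hA : 2 ≤ Nat.card A) (T : Multiset A) (hT : T.card = 2 * Nat.card A - 2)
    (hmax : ∀ a, T.count a ≤ T.count 0) (h0 : 0 ∈ T)
    (hZ : ∀ Z ≤ T, Z.card = Nat.card A → Z.sum ≠ 0) :
    ∃ g, addOrderOf g = Nat.card A ∧
      T = Multiset.replicate (Nat.card A - 1) 0 + Multiset.replicate (Nat.card A - 1) g := by
  set n := Nat.card A with hn
  set h := T.count 0 with hh
  have hh1 : 1 ≤ h := Multiset.count_pos.2 h0
  set W := T.filter (fun x => ¬ x = 0) with hW
  have hTW : T = Multiset.replicate h 0 + W := by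
    rw [hh, ← Multiset.filter_eq']
    exact (Multiset.filter_add_not _ T).symm
  have hW0 : (0 : A) ∉ W := by simp [hW]
  have hcW : h + W.card = 2 * n - 2 := by
    have := congrArg Multiset.card hTW
    rw [Multiset.card_add, Multiset.card_replicate] at this
    omega
  have hWc : ∀ a, W.count a ≤ h := fun a =>
    (Multiset.count_le_of_le a (Multiset.filter_le _ T)).trans (hmax a)
  have hhn : h ≤ n - 1 := by
    by_contra hlt
    refine hZ (Multiset.replicate n 0) ?_ (by simp) (by simp)
    rw [← Multiset.le_count_iff_replicate_le]
    omega
  -- zero-sum subsequences of `W` are either shorter than `n - h` or longer than `n`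
  have hZW : ∀ Z ≤ W, Z.sum = 0 → Z.card ≤ n → Z.card + h + 1 ≤ n := by
    intro Z hZW hZs hZc
    by_contra hlt
    refine hZ (Multiset.replicate (n - Z.card) 0 + Z) ?_ (by simp; omega) (by simp [hZs])
    rw [hTW]
    refine add_le_add (Multiset.replicate_le_replicate 0 |>.2 (by omega)) hZW
  -- Removing a longest zero-sum subsequence of length at most `n` leaves `W'` without zero-sums of
  -- length up to `n - |Z|`, and `n - |Z| ≥ h + 1`.
  obtain ⟨Z, hZle, hZc, hZs, hZmax⟩ := exists_longest_zero_sum W n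
  have hZh := hZW Z hZle hZs hZc
  set W' := W - Z with hW'
  have hWZ : W' + Z = W := tsub_add_cancel_of_le hZle
  have hW'le : W' ≤ W := tsub_le_self
  have hW'c : W'.card + Z.card = W.card := by rw [← Multiset.card_add, hWZ]
  have hfree : ∀ Y ≤ W', Y.card ≤ n - Z.card → Y.sum = 0 → Y = 0 := by
    intro Y hY hYc hYs
    have := hZmax (Y + Z) (by rw [← hWZ]; exact Multiset.add_le_add_right hY)
      (by rw [Multiset.card_add]; omega) (by simp [hYs, hZs])
    rw [Multiset.card_add] at this
    exact Multiset.card_eq_zero.1 (by omega)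
  have hW'count : ∀ a, W'.count a ≤ h := fun a => (Multiset.count_le_of_le a hW'le).trans (hWc a)
  have h1 := card_lt_of_no_short_zero_sum h W' hW'count
    (fun Y hY hYc hYs => hfree Y hY (by omega) hYs)
  -- The bound on `Z` gives `|W'| = 2n - 2 - h - |Z| ≥ n - 1`, and `h1` gives the reverse. Two
  -- distinct terms in `W'` would improve `h1` by one, so `W'` is constant.
  have hcard : W'.card = n - 1 := by omega
  have hconst : ∀ x ∈ W', ∀ y ∈ W', x = y := by
    intro x hx y hy
    by_contra hxy
    obtain ⟨k, hk⟩ : ∃ k, h = k + 1 := ⟨h - 1, by omega⟩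
    rw [hk] at hW'count
    have hne : ∀ z ∈ W', z ≠ 0 := fun z hz h => hW0 (h ▸ Multiset.mem_of_le hW'le hz)
    have key : W'.card + 2 ≤ Nat.card A := by
      by_cases hx2 : x + x = 0
      · have hy2 : y + y ≠ 0 := fun hy2 =>
          hxy (eq_of_add_self_eq_zero (hne x hx) (hne y hy) hx2 hy2)
        exact card_add_two_le_of_no_short_zero_sum k W' hW'count
          (fun Y hY hYc hYs => hfree Y hY (by omega) hYs) hy hx (Ne.symm hxy) hy2
      · exact card_add_two_le_of_no_short_zero_sum k W' hW'count
          (fun Y hY hYc hYs => hfree Y hY (by omega) hYs) hx hy hxy hx2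
    omega
  obtain ⟨g, hg⟩ : ∃ g, g ∈ W' := Multiset.card_pos_iff_exists_mem.1 (by omega)
  have hrep : W' = Multiset.replicate (n - 1) g :=
    Multiset.eq_replicate.2 ⟨hcard, fun b hb => hconst b hb g hg⟩
  have hh' : n - 1 ≤ h := by
    have := hW'count g
    rw [hrep, Multiset.count_replicate_self] at this
    exact this
  have hheq : h = n - 1 := by omega
  have hZ0 : Z = 0 := Multiset.card_eq_zero.1 (by omega)
  refine ⟨g, ?_, ?_⟩
  · refine le_antisymm (Nat.le_of_dvd (by omega) (addOrderOf_dvd_natCard g)) ?_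
    by_contra hlt
    have hpos : 0 < addOrderOf g := addOrderOf_pos g
    have := hfree (Multiset.replicate (addOrderOf g) g)
      (by rw [hrep]; exact (Multiset.replicate_le_replicate g).2 (by omega))
      (by rw [Multiset.card_replicate, hZ0]; simp; omega)
      (by simp [addOrderOf_nsmul_eq_zero])
    have := congrArg Multiset.card this
    rw [Multiset.card_replicate, Multiset.card_zero] at this
    omega
  · rw [hTW, hheq, ← hWZ, hZ0, hrep]; simp

/-- The inverse Erdős–Ginzburg–Ziv theorem for cyclic groups. -/
theorem eq_replicate_of_no_zero_sum [Finite A] [IsAddCyclic A]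
    (hA : 2 ≤ Nat.card A) (T : Multiset A) (hT : T.card = 2 * Nat.card A - 2)
    (hZ : ∀ Z ≤ T, Z.card = Nat.card A → Z.sum ≠ 0) :
    ∃ a b, addOrderOf (b - a) = Nat.card A ∧
      T = Multiset.replicate (Nat.card A - 1) a + Multiset.replicate (Nat.card A - 1) b := by
  classical
  obtain ⟨x, hx⟩ : ∃ x, x ∈ T := Multiset.card_pos_iff_exists_mem.1 (by omega)
  obtain ⟨a, ha, hmax⟩ := Finset.exists_max_image T.toFinset (fun a => T.count a) ⟨x, by simpa⟩
  have hmax' : ∀ b, T.count b ≤ T.count a := by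
    intro b
    by_cases hb : b ∈ T
    · exact hmax b (by simpa using hb)
    · simp [Multiset.count_eq_zero_of_notMem hb]
  have hinj : Function.Injective (fun x : A => x + -a) := add_left_injective (-a)
  have hcount : ∀ b, (T.map (· + -a)).count b = T.count (b + a) := by
    intro b
    have := Multiset.count_map_eq_count' (fun x : A => x + -a) T hinj (b + a)
    simpa using this
  -- Translating the most frequent term to `0` does not change sums of `n` terms, since `n`
  -- annihilates the group.
  obtain ⟨g, hg, hgT⟩ := eq_replicate_of_no_zero_sum_of_max hA (T.map (· + -a)) (by simpa using hT)
    (by intro b; rw [hcount, hcount]; simpa using hmax' (b + a))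
    (by rw [← Multiset.count_pos, hcount, zero_add, Multiset.count_pos]; simpa using ha)
    (by
      intro Z hZle hZc hZs
      refine hZ (Z.map (· + a)) ?_ (by simpa using hZc) ?_
      · simpa using Multiset.map_le_map (f := (· + a)) hZle
      · rw [sum_map_add_const, hZs, hZc, card_nsmul_eq_zero', add_zero])
  refine ⟨a, g + a, by simpa using hg, ?_⟩
  have := congrArg (Multiset.map (· + a)) hgT
  simpa using this

/-- Adjoin the term `-t - σ(T)`. A zero-sum of length `n` through it has, as complement in `T`, `n -
2` terms with sum `-t`, which is excluded. So the inverse theorem applies to the enlarged sequence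
of length `2n - 2`, and `t` is read off from the value of the new term. -/
theorem exists_replicate_of_missing_sum [Finite A] [IsAddCyclic A]
    (hA : 2 ≤ Nat.card A) (T : Multiset A) (hT : T.card = 2 * Nat.card A - 3)
    (hZ : ∀ Z ≤ T, Z.card = Nat.card A → Z.sum ≠ 0) (t : A)
    (ht : ∀ Z ≤ T, Z.card = Nat.card A - 2 → Z.sum + t ≠ 0) :
    ∃ a b, a ≠ b ∧ t = a + b ∧
      T = Multiset.replicate (Nat.card A - 1) a + Multiset.replicate (Nat.card A - 2) b := by
  classical
  set n := Nat.card A with hn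
  obtain ⟨m, hm⟩ : ∃ m, n = m + 2 := ⟨n - 2, by omega⟩
  obtain ⟨a, b, hab, hTab⟩ := eq_replicate_of_no_zero_sum hA ((-t - T.sum) ::ₘ T)
    (by rw [Multiset.card_cons]; omega) (by
      intro Z hZle hZc hZs
      by_cases hx : Z ≤ T
      · exact hZ Z hx hZc hZs
      have hmem : (-t - T.sum) ∈ Z := by
        by_contra hnot
        exact hx ((Multiset.le_cons_of_notMem hnot).1 hZle)
      obtain ⟨Y, rfl⟩ := Multiset.exists_cons_of_mem hmem
      have hY : Y ≤ T := (Multiset.cons_le_cons_iff _).1 hZle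
      rw [Multiset.card_cons] at hZc
      have hcomp : T - Y + Y = T := tsub_add_cancel_of_le hY
      have hcc := congrArg Multiset.card hcomp
      have hss := congrArg Multiset.sum hcomp
      rw [Multiset.card_add] at hcc
      rw [Multiset.sum_add] at hss
      refine ht (T - Y) tsub_le_self (by omega) ?_
      rw [Multiset.sum_cons] at hZs
      have : (T - Y).sum + t = -(-t - T.sum + Y.sum) := by rw [← hss]; abel
      rw [this, hZs, neg_zero])
  rw [← hn] at hTab hab
  have hne : a ≠ b := by
    rintro rfl
    simp at hab
    omega
  -- it suffices to treat one of the two possible positions of the new term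
  have key : ∀ a b : A, a ≠ b → -t - T.sum = b →
      (-t - T.sum) ::ₘ T = Multiset.replicate (n - 1) a + Multiset.replicate (n - 1) b →
      t = a + b ∧ T = Multiset.replicate (n - 1) a + Multiset.replicate (n - 2) b := by
    intro a b _ hb hTab
    have hT' : T = Multiset.replicate (n - 1) a + Multiset.replicate (n - 2) b := by
      rw [show n - 1 = (n - 2) + 1 by omega] at hTab
      nth_rewrite 2 [Multiset.replicate_succ] at hTab
      rw [Multiset.add_cons, hb, Multiset.cons_inj_right] at hTab
      rw [hTab, show n - 1 = (n - 2) + 1 by omega]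
    refine ⟨?_, hT'⟩
    have hna : n • a = 0 := card_nsmul_eq_zero'
    have hnb : n • b = 0 := card_nsmul_eq_zero'
    have hs : T.sum = (n - 1) • a + (n - 2) • b := by rw [hT']; simp
    rw [hm] at hs hna hnb
    simp only [Nat.add_sub_cancel, show m + 2 - 1 = m + 1 by omega] at hs
    have : t = -b - T.sum := by rw [← hb]; abel
    rw [this, hs]
    have e1 : -b - ((m + 1) • a + m • b) = a + b - (m + 2) • a - (m + 2) • b := by
      simp only [add_nsmul]; abel
    rw [e1, hna, hnb]; simp
  have hmem : (-t - T.sum) ∈ Multiset.replicate (n - 1) a + Multiset.replicate (n - 1) b := by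
    rw [← hTab]; exact Multiset.mem_cons_self _ _
  rcases Multiset.mem_add.1 hmem with h | h
  · have h' := Multiset.eq_of_mem_replicate h
    obtain ⟨h1, h2⟩ := key b a hne.symm h' (by rw [hTab, add_comm])
    exact ⟨b, a, hne.symm, h1, h2⟩
  · have h' := Multiset.eq_of_mem_replicate h
    obtain ⟨h1, h2⟩ := key a b hne h' hTab
    exact ⟨a, b, hne, h1, h2⟩

/-- If an element `-t` is not the sum of an `(n - 2)`-term subsequence of a sequence `T` of length
`2n - 3` over a cyclic group of order `n`, and `T` has no `n`-term zero-sum subsequence, then `T`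
takes two values, and `t` is their sum. -/
theorem exists_replicate_of_missing_sums [Finite A] [IsAddCyclic A]
    (hA : 2 ≤ Nat.card A) (T : Multiset A) (hT : T.card = 2 * Nat.card A - 3)
    (hZ : ∀ Z ≤ T, Z.card = Nat.card A → Z.sum ≠ 0) (t : A)
    (ht : ∀ Z ≤ T, Z.card = Nat.card A - 2 → Z.sum + t ≠ 0) :
    ∃ a b, a ≠ b ∧
      T = Multiset.replicate (Nat.card A - 1) a + Multiset.replicate (Nat.card A - 2) b ∧
      ∀ t, (∀ Z ≤ T, Z.card = Nat.card A - 2 → Z.sum + t ≠ 0) → t = a + b := by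
  obtain ⟨a, b, hab, -, hTab⟩ := exists_replicate_of_missing_sum hA T hT hZ t ht
  refine ⟨a, b, hab, hTab, fun t ht => ?_⟩
  obtain ⟨a', b', hab', h1, h2⟩ := exists_replicate_of_missing_sum hA T hT hZ t ht
  obtain ⟨rfl, rfl⟩ := replicate_add_replicate_unique hA hab hab' rfl (hTab.symm.trans h2)
  exact h1

/-- The inverse theorem gives the shape of `T`; dropping one copy of `b` reduces the claim on `t` to
length `2n - 3`. -/
theorem eq_replicate_of_no_zero_sum_of_missing_sum [Finite A] [IsAddCyclic A]
    (hA : 2 ≤ Nat.card A) (T : Multiset A) (hT : T.card = 2 * Nat.card A - 2)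
    (hZ : ∀ Z ≤ T, Z.card = Nat.card A → Z.sum ≠ 0) (t : A)
    (ht : ∀ Z ≤ T, Z.card = Nat.card A - 2 → Z.sum + t ≠ 0) :
    ∃ a b, addOrderOf (b - a) = Nat.card A ∧ t = a + b ∧
      T = Multiset.replicate (Nat.card A - 1) a + Multiset.replicate (Nat.card A - 1) b := by
  obtain ⟨a, b, hab, hTab⟩ := eq_replicate_of_no_zero_sum hA T hT hZ
  refine ⟨a, b, hab, ?_, hTab⟩
  have hne : a ≠ b := by
    rintro rfl
    simp at hab
    omega
  set T' := Multiset.replicate (Nat.card A - 1) a + Multiset.replicate (Nat.card A - 2) b with hT'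
  have hle : T' ≤ T := by
    rw [hTab, hT']
    exact add_le_add le_rfl ((Multiset.replicate_le_replicate b).2 (by omega))
  obtain ⟨a', b', hab', h1, h2⟩ := exists_replicate_of_missing_sum hA T'
    (by simp [hT']; omega) (fun Z h => hZ Z (h.trans hle)) t (fun Z h => ht Z (h.trans hle))
  obtain ⟨rfl, rfl⟩ := replicate_add_replicate_unique hA hne hab' rfl h2
  exact h1

end Cyclic

/-! ### Transfer of the cyclic results to sequences over `G` with terms in a cyclic subgroup. -/

section Subgroup

variable {G : Type*} [AddCommGroup G] (K : AddSubgroup G)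

theorem exists_lift (T : Multiset G) (hT : ∀ t ∈ T, t ∈ K) :
    ∃ T' : Multiset K, T = T'.map (fun x : K => (x : G)) := by
  lift T to Multiset K using hT
  exact ⟨T, rfl⟩

theorem sum_map_coe (Z : Multiset K) : (Z.map (fun x : K => (x : G))).sum = (Z.sum : K) :=
  (map_multiset_sum K.subtype Z).symm

variable [Finite K] [IsAddCyclic K]

theorem subgroup_exists_zero_sum (T : Multiset G) (hT : ∀ t ∈ T, t ∈ K)
    (hc : 2 * Nat.card K - 1 ≤ T.card) : ∃ Z ≤ T, Z.card = Nat.card K ∧ Z.sum = 0 := by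
  obtain ⟨T, rfl⟩ := exists_lift K T hT
  obtain ⟨Z, hZ, hZc, hZs⟩ := exists_zero_sum_of_card_ge T (by simpa using hc)
  exact ⟨Z.map _, Multiset.map_le_map hZ, by simpa using hZc, by simp [sum_map_coe, hZs]⟩

theorem subgroup_eq_replicate (hA : 2 ≤ Nat.card K) (T : Multiset G) (hT : ∀ t ∈ T, t ∈ K)
    (hc : T.card = 2 * Nat.card K - 2) (hZ : ∀ Z ≤ T, Z.card = Nat.card K → Z.sum ≠ 0)
    (t : G) (htK : t ∈ K) (ht : ∀ Z ≤ T, Z.card = Nat.card K - 2 → Z.sum + t ≠ 0) :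
    ∃ a b, a ∈ K ∧ b ∈ K ∧ addOrderOf (b - a) = Nat.card K ∧ t = a + b ∧
      T = Multiset.replicate (Nat.card K - 1) a + Multiset.replicate (Nat.card K - 1) b := by
  obtain ⟨T, rfl⟩ := exists_lift K T hT
  obtain ⟨a, b, hab, h1, h⟩ := eq_replicate_of_no_zero_sum_of_missing_sum hA T (by simpa using hc)
    (fun Z hZle hZc hZs => hZ (Z.map _) (Multiset.map_le_map hZle) (by simpa using hZc)
      (by rw [sum_map_coe, hZs]; rfl)) ⟨t, htK⟩ (by
    intro Z hZ hZc hZs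
    refine ht (Z.map _) (Multiset.map_le_map hZ) (by simpa using hZc) ?_
    have := congrArg Subtype.val hZs
    rw [sum_map_coe]
    exact this)
  refine ⟨a, b, a.2, b.2, ?_, congrArg Subtype.val h1, ?_⟩
  · rw [← hab, ← AddSubgroup.coe_sub, AddSubgroup.addOrderOf_coe]
  · rw [h]; simp

theorem subgroup_exists_replicate (hA : 2 ≤ Nat.card K) (T : Multiset G) (hT : ∀ t ∈ T, t ∈ K)
    (hc : T.card = 2 * Nat.card K - 3) (hZ : ∀ Z ≤ T, Z.card = Nat.card K → Z.sum ≠ 0)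
    (t : G) (htK : t ∈ K) (ht : ∀ Z ≤ T, Z.card = Nat.card K - 2 → Z.sum + t ≠ 0) :
    ∃ a b, a ≠ b ∧
      T = Multiset.replicate (Nat.card K - 1) a + Multiset.replicate (Nat.card K - 2) b ∧
      ∀ t ∈ K, (∀ Z ≤ T, Z.card = Nat.card K - 2 → Z.sum + t ≠ 0) → t = a + b := by
  obtain ⟨T, rfl⟩ := exists_lift K T hT
  have key : ∀ t : K, (∀ Z ≤ T.map (fun x : K => (x : G)), Z.card = Nat.card K - 2 →
      Z.sum + t ≠ 0) → ∀ Z ≤ T, Z.card = Nat.card K - 2 → Z.sum + t ≠ 0 := by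
    intro t ht Z hZ hZc hZs
    refine ht (Z.map _) (Multiset.map_le_map hZ) (by simpa using hZc) ?_
    rw [sum_map_coe, ← AddSubgroup.coe_add, hZs]; rfl
  obtain ⟨a, b, hab, h, huniq⟩ := exists_replicate_of_missing_sums hA T (by simpa using hc)
    (fun Z hZle hZc hZs => hZ (Z.map _) (Multiset.map_le_map hZle) (by simpa using hZc)
      (by rw [sum_map_coe, hZs]; rfl)) ⟨t, htK⟩ (key ⟨t, htK⟩ ht)
  refine ⟨a, b, fun h => hab (Subtype.ext h), by rw [h]; simp, fun t htK ht => ?_⟩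
  exact congrArg Subtype.val (huniq ⟨t, htK⟩ (key ⟨t, htK⟩ ht))

end Subgroup

/-! ### Pairs in a common fibre, and planes of unpaired terms. -/

section Pairs

/-- The sequence of the entries of a sequence of pairs. -/
def entries {G : Type*} (P : Multiset (G × G)) : Multiset G := P.map Prod.fst + P.map Prod.snd

theorem card_entries {G : Type*} (P : Multiset (G × G)) : (entries P).card = 2 * P.card := by
  simp [entries, two_mul]

theorem entries_cons {G : Type*} (x y : G) (P : Multiset (G × G)) :
    entries ((x, y) ::ₘ P) = {x} + {y} + entries P := by
  rw [entries, entries, Multiset.map_cons, Multiset.map_cons, ← Multiset.singleton_add,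
    ← Multiset.singleton_add]
  abel

theorem entries_le {G : Type*} {P Q : Multiset (G × G)} (h : Q ≤ P) : entries Q ≤ entries P :=
  add_le_add (Multiset.map_le_map h) (Multiset.map_le_map h)

variable {G : Type*} [AddCommGroup G]

/-- The sequence of the sums of a sequence of pairs. -/
def pairSums (P : Multiset (G × G)) : Multiset G := P.map fun p => p.1 + p.2

theorem sum_entries (P : Multiset (G × G)) : (entries P).sum = (pairSums P).sum := by
  simp [entries, pairSums, Multiset.sum_map_add]

theorem card_pairSums (P : Multiset (G × G)) : (pairSums P).card = P.card := by
  simp [pairSums]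

theorem exists_le_card_eq {B : Type*} {k : ℕ} {P : Multiset B} (h : k ≤ P.card) :
    ∃ Q ≤ P, Q.card = k := by
  have h1 : 0 < (P.powersetCard k).card := by
    rw [Multiset.card_powersetCard]; exact Nat.choose_pos h
  obtain ⟨Q, hQ⟩ := Multiset.card_pos_iff_exists_mem.1 h1
  exact ⟨Q, Multiset.mem_powersetCard.1 hQ⟩

theorem exists_le_map_eq {B C : Type*} (f : B → C) (P : Multiset B) (Z : Multiset C)
    (h : Z ≤ P.map f) : ∃ Q ≤ P, Q.map f = Z := by
  classical
  induction P using Multiset.induction_on generalizing Z with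
  | empty => exact ⟨0, le_rfl, (Multiset.le_zero.1 (by simpa using h)).symm⟩
  | cons p P ih =>
    rw [Multiset.map_cons] at h
    by_cases hp : f p ∈ Z
    · obtain ⟨Z, rfl⟩ := Multiset.exists_cons_of_mem hp
      obtain ⟨Q, hQ, rfl⟩ := ih Z ((Multiset.cons_le_cons_iff _).1 h)
      exact ⟨p ::ₘ Q, (Multiset.cons_le_cons_iff _).2 hQ, by simp⟩
    · obtain ⟨Q, hQ, rfl⟩ := ih Z ((Multiset.le_cons_of_notMem hp).1 h)
      exact ⟨Q, hQ.trans (Multiset.le_cons_self _ _), rfl⟩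

/-- `S` has no zero-sum subsequence of length `ℓ`. -/
def NoZeroSum (ℓ : ℕ) (S : Multiset G) : Prop := ∀ Z ≤ S, Z.card = ℓ → Z.sum ≠ 0

variable {V : Type*} [AddCommGroup V] (π : G →+ V)

/-- Every sequence is a sequence of pairs with entries in the same fibre of `π`, together with
a sequence of elements in distinct fibres. -/
theorem exists_pairing (S : Multiset G) : ∃ P : Multiset (G × G), ∃ U : Multiset G,
    S = entries P + U ∧ (∀ p ∈ P, π p.1 = π p.2) ∧ (U.map π).Nodup := by
  classical
  induction S using Multiset.induction_on with
  | empty => exact ⟨0, 0, by simp [entries]⟩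
  | cons x S ih =>
    obtain ⟨P, U, rfl, hP, hU⟩ := ih
    by_cases hx : π x ∈ U.map π
    · obtain ⟨y, hy, hyx⟩ := Multiset.mem_map.1 hx
      obtain ⟨U, rfl⟩ := Multiset.exists_cons_of_mem hy
      refine ⟨(x, y) ::ₘ P, U, ?_, ?_, ?_⟩
      · rw [entries_cons, ← Multiset.singleton_add, ← Multiset.singleton_add]
        abel
      · intro p hp
        rcases Multiset.mem_cons.1 hp with rfl | hp
        · exact hyx.symm
        · exact hP p hp
      · rw [Multiset.map_cons] at hU
        exact (Multiset.nodup_cons.1 hU).2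
    · refine ⟨P, x ::ₘ U, ?_, hP, ?_⟩
      · rw [Multiset.add_cons]
      · rw [Multiset.map_cons]
        exact Multiset.nodup_cons.2 ⟨hx, hU⟩

/-- Unpaired terms in distinct fibres can be indexed by the set `W` of those fibres, which turns
statements about `U` into finite ones about `V`. -/
theorem exists_section (U : Multiset G) (hU : (U.map π).Nodup) :
    ∃ s : V → G, ∃ W : Finset V, U = W.val.map s ∧ ∀ v ∈ W, π (s v) = v := by
  classical
  let s : V → G := fun v => if h : ∃ u ∈ U, π u = v then h.choose else 0
  have hs : ∀ u ∈ U, s (π u) = u ∧ π (s (π u)) = π u := by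
    intro u hu
    have h : ∃ u' ∈ U, π u' = π u := ⟨u, hu, rfl⟩
    have hsu : s (π u) = h.choose := dif_pos h
    have h2 := h.choose_spec
    rw [hsu]
    exact ⟨Multiset.inj_on_of_nodup_map hU _ h2.1 _ hu h2.2, h2.2⟩
  refine ⟨s, ⟨U.map π, hU⟩, ?_, ?_⟩
  · simp only [Multiset.map_map]
    conv_lhs => rw [← Multiset.map_id U]
    exact Multiset.map_congr rfl fun u hu => (hs u hu).1.symm
  · intro v hv
    obtain ⟨u, hu, rfl⟩ := Multiset.mem_map.1 (Finset.mem_def.1 hv)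
    exact (hs u hu).2

theorem pairSums_mem_ker (hV : ∀ v : V, v + v = 0) {P : Multiset (G × G)}
    (hP : ∀ p ∈ P, π p.1 = π p.2) : ∀ t ∈ pairSums P, t ∈ π.ker := by
  intro t ht
  obtain ⟨p, hp, rfl⟩ := Multiset.mem_map.1 ht
  rw [AddMonoidHom.mem_ker, map_add, hP p hp, hV]

variable {n : ℕ}

theorem NoZeroSum.pairSums {S : Multiset G} (hS : NoZeroSum (2 * n) S) {P : Multiset (G × G)}
    (hP : entries P ≤ S) : NoZeroSum n (pairSums P) := by
  intro Z hZ hZc hZs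
  obtain ⟨Q, hQ, rfl⟩ := exists_le_map_eq _ P Z hZ
  refine hS (entries Q) ((entries_le hQ).trans hP) ?_ ?_
  · rw [card_entries]
    rw [Multiset.card_map] at hZc
    omega
  · rw [sum_entries]
    exact hZs

variable (hV : ∀ v : V, v + v = 0) (hn : 2 ≤ n) (hK : Nat.card π.ker = n) [IsAddCyclic π.ker]
include hV hn hK

/-- The four-term subsequences of `U` with sum in `π.ker` all have the same sum, and this sum is
tied to the shape of the sequence of pair sums. -/
theorem exists_pairSums_eq {S : Multiset G} (hS : NoZeroSum (2 * n) S) {P : Multiset (G × G)}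
    {U : Multiset G} (hPU : entries P + U ≤ S) (hP : ∀ p ∈ P, π p.1 = π p.2)
    (hPc : P.card = 2 * n - 3) {X : Multiset G} (hX : X ≤ U) (hXc : X.card = 4)
    (hXπ : π X.sum = 0) :
    ∃ a b, a ≠ b ∧ pairSums P = Multiset.replicate (n - 1) a + Multiset.replicate (n - 2) b ∧
      ∀ Y ≤ U, Y.card = 4 → π Y.sum = 0 → Y.sum = a + b := by
  have : Finite π.ker := Nat.finite_of_card_ne_zero (by omega)
  have key : ∀ Y ≤ U, Y.card = 4 → ∀ Z ≤ pairSums P, Z.card = Nat.card π.ker - 2 →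
      Z.sum + Y.sum ≠ 0 := by
    intro Y hY hYc Z hZ hZc hs
    obtain ⟨Q, hQ, rfl⟩ := exists_le_map_eq _ P Z hZ
    refine hS (entries Q + Y) ((add_le_add (entries_le hQ) hY).trans hPU) ?_ ?_
    · rw [Multiset.card_add, card_entries]
      rw [Multiset.card_map] at hZc
      omega
    · rw [Multiset.sum_add, sum_entries]
      exact hs
  obtain ⟨a, b, hab, h1, h2⟩ := subgroup_exists_replicate π.ker (by omega) (pairSums P)
    (pairSums_mem_ker π hV hP) (by rw [card_pairSums]; omega)
    (by rw [hK]; exact hS.pairSums ((Multiset.le_add_right _ _).trans hPU)) X.sum hXπ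
    (key X hX hXc)
  exact ⟨a, b, hab, hK ▸ h1, fun Y hY hYc hYπ => h2 Y.sum hYπ (key Y hY hYc)⟩

/-- Any `2n - 3` of the pairs fix the values `a, b`, and every plane sum equals `a + b`. -/
theorem plane_sum_eq {S : Multiset G} (hS : NoZeroSum (2 * n) S) {P : Multiset (G × G)}
    {U : Multiset G} (hPU : entries P + U ≤ S) (hP : ∀ p ∈ P, π p.1 = π p.2)
    (hPc : 2 * n - 3 ≤ P.card) {X Y : Multiset G} (hX : X ≤ U) (hXc : X.card = 4)
    (hXπ : π X.sum = 0) (hY : Y ≤ U) (hYc : Y.card = 4) (hYπ : π Y.sum = 0) :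
    X.sum = Y.sum := by
  obtain ⟨Q, hQ, hQc⟩ := exists_le_card_eq hPc
  obtain ⟨a, b, -, -, h⟩ := exists_pairSums_eq π hV hn hK hS (P := Q)
    ((Multiset.add_le_add_right (entries_le hQ)).trans hPU)
    (fun p hp => hP p (Multiset.mem_of_le hQ hp)) hQc hX hXc hXπ
  rw [h X hX hXc hXπ, h Y hY hYc hYπ]

/-- An unpaired element equals every paired element of its fibre, if there are suitable
four-term subsequences. -/
theorem eq_of_mem_entries {S : Multiset G} (hS : NoZeroSum (2 * n) S) {P : Multiset (G × G)}
    {U : Multiset G} {s x : G} (hPU : entries P + ({s} + U) ≤ S)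
    (hP : ∀ p ∈ P, π p.1 = π p.2) (hPc : 2 * n - 3 ≤ P.card)
    (hx : x ∈ entries P) (hxs : π x = π s)
    {X Y : Multiset G} (hX : X ≤ U) (hXc : X.card = 3)
    (hXπ : π (s + X.sum) = 0) (hY : Y ≤ U) (hYc : Y.card = 4) (hYπ : π Y.sum = 0) :
    x = s := by
  have h1 : ({s} + X : Multiset G).sum = Y.sum :=
    plane_sum_eq π hV hn hK hS hPU hP hPc (add_le_add le_rfl hX) (by simp; omega)
      (by simpa using hXπ) (hY.trans (Multiset.le_add_left _ _)) hYc hYπ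
  -- Exchange `x` and `s`: they lie in the same fibre, so the new pairing is also admissible. The
  -- planes `{s} + X` and `{x} + X` both have the sum of the plane `Y`, which the exchange does not
  -- touch.
  have h2 : ∃ Q : Multiset (G × G), entries Q + ({x} + U) = entries P + ({s} + U) ∧
      (∀ p ∈ Q, π p.1 = π p.2) ∧ Q.card = P.card := by
    rcases Multiset.mem_add.1 hx with hx | hx
    · obtain ⟨⟨x, y⟩, hp, rfl⟩ := Multiset.mem_map.1 hx
      obtain ⟨P, rfl⟩ := Multiset.exists_cons_of_mem hp
      refine ⟨(s, y) ::ₘ P, by rw [entries_cons, entries_cons]; abel, ?_, by simp⟩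
      intro p hp'
      rcases Multiset.mem_cons.1 hp' with rfl | hp'
      · exact hxs.symm.trans (hP _ hp)
      · exact hP p (Multiset.mem_cons_of_mem hp')
    · obtain ⟨⟨y, x⟩, hp, rfl⟩ := Multiset.mem_map.1 hx
      obtain ⟨P, rfl⟩ := Multiset.exists_cons_of_mem hp
      refine ⟨(y, s) ::ₘ P, by rw [entries_cons, entries_cons]; abel, ?_, by simp⟩
      intro p hp'
      rcases Multiset.mem_cons.1 hp' with rfl | hp'
      · exact (hP _ hp).trans hxs
      · exact hP p (Multiset.mem_cons_of_mem hp')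
  obtain ⟨Q, hQU, hQ, hQc⟩ := h2
  have h3 : ({x} + X : Multiset G).sum = Y.sum :=
    plane_sum_eq π hV hn hK hS (hQU.trans_le hPU) hQ (hPc.trans_eq hQc.symm)
      (add_le_add le_rfl hX) (by simp; omega)
      (by simpa [hxs] using hXπ) (hY.trans (Multiset.le_add_left _ _)) hYc hYπ
  have h4 := h3.trans h1.symm
  simpa using h4

end Pairs

/-! ### Eight unpaired terms are impossible. -/

/-- The elementary abelian group of order eight. -/
abbrev EightGroup : Type := ZMod 2 × ZMod 2 × ZMod 2

theorem EightGroup.add_self (v : EightGroup) : v + v = 0 := by revert v; decide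

theorem EightGroup.two_eq_zero : (2 : EightGroup) = 0 := by decide

section Fibres

variable {G : Type*} [AddCommGroup G] {n : ℕ} (π : G →+ EightGroup) (hn : 2 ≤ n)
  (hK : Nat.card π.ker = n) [IsAddCyclic π.ker]
include hn hK

/-- A sequence without zero-sum subsequence of length `2n` cannot be split into `2n - 3` pairs and
eight elements from the eight fibres. -/
theorem false_of_eight_fibres {S : Multiset G} (hS : NoZeroSum (2 * n) S)
    {P : Multiset (G × G)} (hP : ∀ p ∈ P, π p.1 = π p.2) (hPc : P.card = 2 * n - 3)
    (s : EightGroup → G) (hs : ∀ v, π (s v) = v)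
    (hPU : entries P + (Finset.univ.val.map s) ≤ S) : False := by
  have hle : ∀ M : Multiset EightGroup, M.Nodup → M.map s ≤ Finset.univ.val.map s := fun M hM =>
    Multiset.map_le_map ((Multiset.le_iff_subset hM).2 fun v _ => Finset.mem_univ_val v)
  have hπ : ∀ M : Multiset EightGroup, π (M.map s).sum = M.sum := by
    intro M
    rw [map_multiset_sum, Multiset.map_map]
    congr 1
    simp [hs]
  obtain ⟨a, b, hab, hT, hc⟩ := exists_pairSums_eq π EightGroup.add_self hn hK hS hPU hP hPc
    (X := ({(0, 0, 0), (0, 0, 1), (0, 1, 0), (0, 1, 1)} : Multiset EightGroup).map s)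
    (hle _ (by decide)) (by simp) (by rw [hπ]; decide)
  have hplane : ∀ w x y z : EightGroup, ({w, x, y, z} : Multiset EightGroup).Nodup →
      w + (x + (y + z)) = 0 → s w + (s x + (s y + s z)) = a + b := by
    intro w x y z hnd h0
    have := hc (({w, x, y, z} : Multiset EightGroup).map s) (hle _ hnd) (by simp)
      (by rw [hπ]; simpa using h0)
    simpa using this
  have ha : a ∈ pairSums P := by
    rw [hT, Multiset.mem_add]
    exact Or.inl (Multiset.mem_replicate.2 ⟨by omega, rfl⟩)
  obtain ⟨p, hp, rfl⟩ := Multiset.mem_map.1 ha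
  obtain ⟨v, hv⟩ : ∃ v, v = π p.1 := ⟨_, rfl⟩
  -- `X` completes `v` to a plane and `Y` is the parallel plane, so the exchange argument applies at
  -- every fibre `v`.
  have hmem : ∀ x ∈ entries P, π x = v → x = s v := by
    intro x hx hxv
    have hsplit : Finset.univ.val.map s = {s v} + (Finset.univ.erase v).val.map s := by
      rw [← Multiset.map_singleton s v, ← Multiset.map_add, Finset.erase_val,
        Multiset.singleton_add, Multiset.cons_erase (Finset.mem_univ_val v)]
    have hle' : ∀ M : Multiset EightGroup, M.Nodup → v ∉ M →
        M.map s ≤ (Finset.univ.erase v).val.map s := fun M hM hvM =>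
      Multiset.map_le_map ((Multiset.le_iff_subset hM).2 fun w hw =>
        (Finset.mem_erase.2
          ⟨fun h : w = v => hvM (h ▸ hw), Finset.mem_univ w⟩))
    refine eq_of_mem_entries π EightGroup.add_self hn hK hS (hsplit ▸ hPU) hP hPc.ge hx
      (by rw [hxv, hs])
      (X := ({v + (0, 0, 1), v + (0, 1, 0), v + (0, 1, 1)} : Multiset EightGroup).map s)
      (hle' _ (by clear * -; revert v; decide) (by clear * -; revert v; decide)) (by simp) ?_
      (Y := ({v + (1, 0, 0), v + (1, 0, 1), v + (1, 1, 0), v + (1, 1, 1)} :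
        Multiset EightGroup).map s)
      (hle' _ (by clear * -; revert v; decide) (by clear * -; revert v; decide)) (by simp) ?_
    · rw [map_add, hπ, hs]
      clear * -; revert v; decide
    · rw [hπ]
      clear * -; revert v; decide
  have h1 := hmem p.1 (Multiset.mem_add.2 (Or.inl (Multiset.mem_map_of_mem _ hp))) hv.symm
  have h2 := hmem p.2 (Multiset.mem_add.2 (Or.inr (Multiset.mem_map_of_mem _ hp)))
    ((hP p hp).symm.trans hv.symm)
  have e1 := hplane v (v + (0, 0, 1)) (v + (0, 1, 0)) (v + (0, 1, 1))
    (by clear * -; revert v; decide) (by clear * -; revert v; decide)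
  have e2 := hplane v (v + (0, 0, 1)) (v + (1, 0, 0)) (v + (1, 0, 1))
    (by clear * -; revert v; decide) (by clear * -; revert v; decide)
  have e3 := hplane v (v + (0, 0, 1)) (v + (1, 1, 0)) (v + (1, 1, 1))
    (by clear * -; revert v; decide) (by clear * -; revert v; decide)
  have e4 := hplane v (v + (0, 1, 0)) (v + (1, 0, 0)) (v + (1, 1, 0))
    (by clear * -; revert v; decide) (by clear * -; revert v; decide)
  have e5 := hplane v (v + (0, 1, 0)) (v + (1, 0, 1)) (v + (1, 1, 1))
    (by clear * -; revert v; decide) (by clear * -; revert v; decide)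
  have e6 := hplane v (v + (0, 1, 1)) (v + (1, 0, 0)) (v + (1, 1, 1))
    (by clear * -; revert v; decide) (by clear * -; revert v; decide)
  have e7 := hplane v (v + (0, 1, 1)) (v + (1, 0, 1)) (v + (1, 1, 0))
    (by clear * -; revert v; decide) (by clear * -; revert v; decide)
  have e8 := hplane (v + (1, 0, 0)) (v + (1, 0, 1)) (v + (1, 1, 0)) (v + (1, 1, 1))
    (by clear * -; revert v; decide) (by clear * -; revert v; decide)
  -- The seven planes through `v` contain `s v` seven times and each other term three times, and two
  -- parallel planes add up to all eight terms: `7(a + b) = 4 s(v) + 3 · 2(a + b)`. As `a = 2 s(v)`,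
  -- this yields `a = b`.
  have e9 : (4 : ℤ) • s v = p.1 + p.2 + b := by
    linear_combination (norm := module)
      e1 + e2 + e3 + e4 + e5 + e6 + e7 - (3 : ℤ) • e1 - (3 : ℤ) • e8
  apply hab
  rw [h1, h2] at e9 ⊢
  linear_combination (norm := module) e9

omit hn hK [IsAddCyclic π.ker] in
-- With `tᵢ = r - sᵢ` the plane relations become `2sᵢ + 2sⱼ = 2r` for `i ≠ j`. So the `2sᵢ`
-- coincide, `2r = 4s₁`, and the doubles of `tᵢ` and `e` follow.
theorem add_self_eq_of_planes {s₁ s₂ s₃ t₁ t₂ t₃ e r : G} (h1 : s₁ + t₁ = r) (h2 : s₂ + t₂ = r)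
    (h3 : s₃ + t₃ = r) (e0 : e + s₁ + s₂ + s₃ = r + r) (e1 : e + s₁ + t₂ + t₃ = r + r)
    (e2 : e + t₁ + s₂ + t₃ = r + r) (e3 : e + t₁ + t₂ + s₃ = r + r) :
    s₁ + s₁ = s₂ + s₂ ∧ s₁ + s₁ = s₃ + s₃ ∧ t₁ + t₁ = s₁ + s₁ ∧ t₂ + t₂ = s₁ + s₁ ∧
      t₃ + t₃ = s₁ + s₁ ∧ e + e = s₁ + s₁ := by
  obtain rfl : t₁ = r - s₁ := by rw [← h1]; abel
  obtain rfl : t₂ = r - s₂ := by rw [← h2]; abel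
  obtain rfl : t₃ = r - s₃ := by rw [← h3]; abel
  obtain rfl : e = r + r - s₁ - s₂ - s₃ := by rw [← e0]; abel
  have k1 : s₂ + s₂ + s₃ + s₃ = r + r := by linear_combination (norm := module) -e1
  have k2 : s₁ + s₁ + s₃ + s₃ = r + r := by linear_combination (norm := module) -e2
  have k3 : s₁ + s₁ + s₂ + s₂ = r + r := by linear_combination (norm := module) -e3
  refine ⟨?_, ?_, ?_, ?_, ?_, ?_⟩
  · linear_combination (norm := module) k2 - k1
  · linear_combination (norm := module) k3 - k1
  · linear_combination (norm := module) k1 - k2 - k3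
  · linear_combination (norm := module) -k3
  · linear_combination (norm := module) -k2
  · linear_combination (norm := module) k1 - k2 - k3 - k1

end Fibres

/-! ### Six unpaired terms: three couples with the same sum. -/

section SixFibres

variable {G : Type*} [AddCommGroup G] {n : ℕ} {π : G →+ EightGroup}

/-- `S` splits into `2n - 2` pairs with entries in the same fibre of `π` and six elements, which form
three pairs with the same difference of fibres. -/
structure SixFibres (π : G →+ EightGroup) (n : ℕ) (S : Multiset G) (P : Multiset (G × G))
    (d : EightGroup) (s₁ t₁ s₂ t₂ s₃ t₃ : G) : Prop where
  fibre_eq : ∀ p ∈ P, π p.1 = π p.2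
  card_eq : P.card = 2 * n - 2
  eq : entries P + ({s₁} + {t₁} + {s₂} + {t₂} + {s₃} + {t₃}) = S
  diff₁ : π t₁ = π s₁ + d
  diff₂ : π t₂ = π s₂ + d
  diff₃ : π t₃ = π s₃ + d

variable {S : Multiset G} {P : Multiset (G × G)} {d : EightGroup} {s₁ t₁ s₂ t₂ s₃ t₃ : G}

theorem SixFibres.flip (h : SixFibres π n S P d s₁ t₁ s₂ t₂ s₃ t₃) :
    SixFibres π n S P d t₁ s₁ s₂ t₂ s₃ t₃ where
  fibre_eq := h.fibre_eq
  card_eq := h.card_eq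
  eq := by rw [← h.eq]; abel
  diff₁ := by rw [h.diff₁, add_assoc, EightGroup.add_self, add_zero]
  diff₂ := h.diff₂
  diff₃ := h.diff₃

theorem SixFibres.rotate (h : SixFibres π n S P d s₁ t₁ s₂ t₂ s₃ t₃) :
    SixFibres π n S P d s₂ t₂ s₃ t₃ s₁ t₁ where
  fibre_eq := h.fibre_eq
  card_eq := h.card_eq
  eq := by rw [← h.eq]; abel
  diff₁ := h.diff₂
  diff₂ := h.diff₃
  diff₃ := h.diff₁

variable (hS : NoZeroSum (2 * n) S) (hn : 2 ≤ n) (hK : Nat.card π.ker = n) [IsAddCyclic π.ker]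
include hS hn hK

/-- Two couples form a plane; compare the planes that share the third couple. -/
theorem SixFibres.add_eq (h : SixFibres π n S P d s₁ t₁ s₂ t₂ s₃ t₃) :
    s₁ + t₁ = s₂ + t₂ := by
  have h2 := EightGroup.two_eq_zero
  have := plane_sum_eq π EightGroup.add_self hn hK hS h.eq.le h.fibre_eq (by rw [h.card_eq]; omega)
    (X := {s₁} + {t₁} + {s₃} + {t₃}) (Y := {s₂} + {t₂} + {s₃} + {t₃})
    (Multiset.le_iff_exists_add.2 ⟨{s₂} + {t₂}, by abel⟩) (by simp) (by
      simp only [Multiset.sum_add, Multiset.sum_singleton, map_add, h.diff₁, h.diff₃]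
      linear_combination (π s₁ + π s₃ + d) * h2)
    (Multiset.le_iff_exists_add.2 ⟨{s₁} + {t₁}, by abel⟩) (by simp) (by
      simp only [Multiset.sum_add, Multiset.sum_singleton, map_add, h.diff₂, h.diff₃]
      linear_combination (π s₂ + π s₃ + d) * h2)
  simpa only [Multiset.sum_add, Multiset.sum_singleton, add_left_inj] using this

theorem SixFibres.eq_of_fibre (h : SixFibres π n S P d s₁ t₁ s₂ t₂ s₃ t₃) {x : G}
    (hx : x ∈ entries P) (hxs : π x = π s₁) : x = s₁ := by
  have h2 := EightGroup.two_eq_zero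
  refine eq_of_mem_entries π EightGroup.add_self hn hK hS
    (U := {t₁} + {s₂} + {t₂} + {s₃} + {t₃}) ?_ h.fibre_eq (by rw [h.card_eq]; omega) hx hxs
    (X := {t₁} + {s₂} + {t₂}) (Y := {s₂} + {t₂} + {s₃} + {t₃})
    (Multiset.le_iff_exists_add.2 ⟨{s₃} + {t₃}, by abel⟩) (by simp) (by
      simp only [Multiset.sum_add, Multiset.sum_singleton, map_add, h.diff₁, h.diff₂]
      linear_combination (π s₁ + π s₂ + d) * h2)
    (Multiset.le_iff_exists_add.2 ⟨{t₁}, by abel⟩) (by simp) (by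
      simp only [Multiset.sum_add, Multiset.sum_singleton, map_add, h.diff₂, h.diff₃]
      linear_combination (π s₂ + π s₃ + d) * h2)
  rw [← h.eq]
  exact (by abel : _ = _).le

/-- Break up the pair containing `e`; the remaining `2n - 3` pairs still suffice, and `e, s₁, s₂,
s₃` is a new plane. -/
theorem SixFibres.add_eq_of_extra (h : SixFibres π n S P d s₁ t₁ s₂ t₂ s₃ t₃) {e : G}
    (he : e ∈ entries P) (hes : π e = π s₁ + π s₂ + π s₃) :
    e + s₁ + s₂ + s₃ = (s₁ + t₁) + (s₁ + t₁) := by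
  have h2 := EightGroup.two_eq_zero
  obtain ⟨e', Q, hQ, hQP⟩ : ∃ e' : G, ∃ Q ≤ P, entries Q + {e} + {e'} = entries P ∧
      Q.card + 1 = P.card := by
    rcases Multiset.mem_add.1 he with hx | hx
    · obtain ⟨⟨x, y⟩, hp, rfl⟩ := Multiset.mem_map.1 hx
      obtain ⟨P, rfl⟩ := Multiset.exists_cons_of_mem hp
      exact ⟨y, P, Multiset.le_cons_self _ _, by rw [entries_cons]; abel, by simp⟩
    · obtain ⟨⟨y, x⟩, hp, rfl⟩ := Multiset.mem_map.1 hx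
      obtain ⟨P, rfl⟩ := Multiset.exists_cons_of_mem hp
      exact ⟨y, P, Multiset.le_cons_self _ _, by rw [entries_cons]; abel, by simp⟩
  have := plane_sum_eq π EightGroup.add_self hn hK hS (P := Q)
    (U := {e} + {e'} + ({s₁} + {t₁} + {s₂} + {t₂} + {s₃} + {t₃}))
    (by rw [← h.eq, ← hQP.1]; exact (by abel : _ = _).le)
    (fun p hp => h.fibre_eq p (Multiset.mem_of_le hQ hp))
    (by have := h.card_eq; omega)
    (X := {e} + {s₁} + {s₂} + {s₃}) (Y := {s₁} + {t₁} + {s₂} + {t₂})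
    (Multiset.le_iff_exists_add.2 ⟨{e'} + {t₁} + {t₂} + {t₃}, by abel⟩) (by simp) (by
      simp only [Multiset.sum_add, Multiset.sum_singleton, map_add, hes]
      linear_combination (π s₁ + π s₂ + π s₃) * h2)
    (Multiset.le_iff_exists_add.2 ⟨{e} + {e'} + {s₃} + {t₃}, by abel⟩) (by simp) (by
      simp only [Multiset.sum_add, Multiset.sum_singleton, map_add, h.diff₁, h.diff₂]
      linear_combination (π s₁ + π s₂ + d) * h2)
  simp only [Multiset.sum_add, Multiset.sum_singleton] at this
  rw [this]
  nth_rewrite 2 [h.add_eq hS hn hK]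
  abel

/-- Flipping two couples changes `π s₁ + π s₂ + π s₃` by `2d = 0`, so the same `e` lies in four
planes with known sums. -/
theorem SixFibres.add_self_eq_of_extra (h : SixFibres π n S P d s₁ t₁ s₂ t₂ s₃ t₃) {e : G}
    (he : e ∈ entries P) (hes : π e = π s₁ + π s₂ + π s₃) :
    s₁ + s₁ = s₂ + s₂ ∧ s₁ + s₁ = s₃ + s₃ ∧ t₁ + t₁ = s₁ + s₁ ∧ t₂ + t₂ = s₁ + s₁ ∧
      t₃ + t₃ = s₁ + s₁ ∧ e + e = s₁ + s₁ := by
  have h2 := EightGroup.two_eq_zero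
  have r2 := h.add_eq hS hn hK
  have r3 := h.rotate.add_eq hS hn hK
  -- the relations for the three other choices of two flips
  have f23 := (h.rotate.flip.rotate.flip.rotate).add_eq_of_extra hS hn hK he
    (by rw [hes, h.diff₂, h.diff₃]; linear_combination (-d) * h2)
  have f13 := (h.flip.rotate.rotate.flip.rotate).add_eq_of_extra hS hn hK he
    (by rw [hes, h.diff₁, h.diff₃]; linear_combination (-d) * h2)
  have f12 := (h.flip.rotate.flip.rotate.rotate).add_eq_of_extra hS hn hK he
    (by rw [hes, h.diff₁, h.diff₂]; linear_combination (-d) * h2)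
  have f0 := h.add_eq_of_extra hS hn hK he hes
  exact add_self_eq_of_planes (r := s₁ + t₁) rfl r2.symm (r2.trans r3).symm f0 f23
    (by rw [f13]; abel) (by rw [f12]; abel)

/-- The fibres of the entries of the pairs are among those of the six elements. -/
theorem SixFibres.no_extra (h : SixFibres π n S P d s₁ t₁ s₂ t₂ s₃ t₃)
    (hall : ∀ v : EightGroup, v = π s₁ ∨ v = π t₁ ∨ v = π s₂ ∨ v = π t₂ ∨ v = π s₃ ∨ v = π t₃ ∨
      v = π s₁ + π s₂ + π s₃ ∨ v = π t₁ + π s₂ + π s₃)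
    {e : G} (he : e ∈ entries P) (hes : π e = π s₁ + π s₂ + π s₃) : False := by
  obtain ⟨g2, g3, k1, k2, k3, -⟩ := h.add_self_eq_of_extra hS hn hK he hes
  have hall' : ∀ x ∈ entries P, x + x = s₁ + s₁ ∧ ∀ y ∈ entries P, π x = π y → x = y := by
    intro x hx
    rcases hall (π x) with hv | hv | hv | hv | hv | hv | hv | hv
    · have := fun z hz => h.eq_of_fibre hS hn hK (x := z) hz
      exact ⟨by rw [this x hx hv], fun y hy hxy => by rw [this x hx hv, this y hy (hxy ▸ hv)]⟩
    · have := fun z hz => h.flip.eq_of_fibre hS hn hK (x := z) hz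
      exact ⟨by rw [this x hx hv, k1], fun y hy hxy => by rw [this x hx hv, this y hy (hxy ▸ hv)]⟩
    · have := fun z hz => h.rotate.eq_of_fibre hS hn hK (x := z) hz
      exact ⟨by rw [this x hx hv, g2], fun y hy hxy => by rw [this x hx hv, this y hy (hxy ▸ hv)]⟩
    · have := fun z hz => h.rotate.flip.eq_of_fibre hS hn hK (x := z) hz
      exact ⟨by rw [this x hx hv, k2], fun y hy hxy => by rw [this x hx hv, this y hy (hxy ▸ hv)]⟩
    · have := fun z hz => h.rotate.rotate.eq_of_fibre hS hn hK (x := z) hz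
      exact ⟨by rw [this x hx hv, g3], fun y hy hxy => by rw [this x hx hv, this y hy (hxy ▸ hv)]⟩
    · have := fun z hz => h.rotate.rotate.flip.eq_of_fibre hS hn hK (x := z) hz
      exact ⟨by rw [this x hx hv, k3], fun y hy hxy => by rw [this x hx hv, this y hy (hxy ▸ hv)]⟩
    · have := fun z hz => h.add_eq_of_extra hS hn hK (e := z) hz
      refine ⟨(h.add_self_eq_of_extra hS hn hK hx hv).2.2.2.2.2, fun y hy hxy => ?_⟩
      have := (this x hx hv).trans (this y hy (hxy ▸ hv)).symm
      simpa [add_assoc] using this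
    · have := fun z hz => h.flip.add_eq_of_extra hS hn hK (e := z) hz
      refine ⟨(h.flip.add_self_eq_of_extra hS hn hK hx hv).2.2.2.2.2.trans k1, fun y hy hxy => ?_⟩
      have := (this x hx hv).trans (this y hy (hxy ▸ hv)).symm
      simpa [add_assoc] using this
  -- Both entries of a pair are equal and have double `2s₁`, so all pair sums coincide. Then `n` of
  -- them sum to zero in a group of order `n`.
  have hrep : pairSums P = Multiset.replicate (2 * n - 2) (s₁ + s₁) := by
    refine Multiset.eq_replicate.2 ⟨by rw [card_pairSums, h.card_eq], ?_⟩
    intro b hb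
    obtain ⟨p, hp, rfl⟩ := Multiset.mem_map.1 hb
    have m1 : p.1 ∈ entries P := Multiset.mem_add.2 (Or.inl (Multiset.mem_map_of_mem _ hp))
    have m2 : p.2 ∈ entries P := Multiset.mem_add.2 (Or.inr (Multiset.mem_map_of_mem _ hp))
    rw [← (hall' p.1 m1).2 p.2 m2 (h.fibre_eq p hp)]
    exact (hall' p.1 m1).1
  refine hS.pairSums (P := P) (by rw [← h.eq]; exact Multiset.le_add_right _ _)
    (Multiset.replicate n (s₁ + s₁))
    (by rw [hrep]; exact (Multiset.replicate_le_replicate _).2 (by omega)) (by simp) ?_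
  have hmem : s₁ + s₁ ∈ π.ker := by rw [AddMonoidHom.mem_ker, map_add, EightGroup.add_self]
  have := card_nsmul_eq_zero' (x := (⟨s₁ + s₁, hmem⟩ : π.ker))
  rw [hK] at this
  simpa using congrArg Subtype.val this

/-- The structure of a sequence without zero-sum subsequence of length `2n` that splits into
`2n - 2` pairs and six elements from distinct fibres. -/
theorem SixFibres.structure_eq (h : SixFibres π n S P d s₁ t₁ s₂ t₂ s₃ t₃)
    (hall : ∀ v : EightGroup, v = π s₁ ∨ v = π t₁ ∨ v = π s₂ ∨ v = π t₂ ∨ v = π s₃ ∨ v = π t₃ ∨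
      v = π s₁ + π s₂ + π s₃ ∨ v = π t₁ + π s₂ + π s₃) :
    s₁ + t₁ = s₂ + t₂ ∧ s₁ + t₁ = s₃ + t₃ ∧ ∃ M : Multiset G, M.card = 2 * n - 2 ∧
      S = M + M + ({s₁} + {t₁} + {s₂} + {t₂} + {s₃} + {t₃}) ∧
      (∀ x ∈ M, x = s₁ ∨ x = t₁ ∨ x = s₂ ∨ x = t₂ ∨ x = s₃ ∨ x = t₃) ∧
      ∃ a b, a ∈ π.ker ∧ b ∈ π.ker ∧ addOrderOf (b - a) = n ∧ (s₁ + t₁) + (s₁ + t₁) = a + b ∧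
        M.map (fun x => x + x) =
          Multiset.replicate (n - 1) a + Multiset.replicate (n - 1) b := by
  have h2 := EightGroup.two_eq_zero
  have hall'' : ∀ v : EightGroup,
      v = π t₁ ∨ v = π s₁ ∨ v = π s₂ ∨ v = π t₂ ∨ v = π s₃ ∨ v = π t₃ ∨
      v = π t₁ + π s₂ + π s₃ ∨ v = π s₁ + π s₂ + π s₃ := by
    intro v; have := hall v; tauto
  have hall' : ∀ x ∈ entries P,
      (x = s₁ ∨ x = t₁ ∨ x = s₂ ∨ x = t₂ ∨ x = s₃ ∨ x = t₃) ∧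
      ∀ y ∈ entries P, π x = π y → x = y := by
    intro x hx
    rcases hall (π x) with hv | hv | hv | hv | hv | hv | hv | hv
    · have := fun z hz => h.eq_of_fibre hS hn hK (x := z) hz
      exact ⟨by simp [this x hx hv], fun y hy hxy => by rw [this x hx hv, this y hy (hxy ▸ hv)]⟩
    · have := fun z hz => h.flip.eq_of_fibre hS hn hK (x := z) hz
      exact ⟨by simp [this x hx hv], fun y hy hxy => by rw [this x hx hv, this y hy (hxy ▸ hv)]⟩
    · have := fun z hz => h.rotate.eq_of_fibre hS hn hK (x := z) hz
      exact ⟨by simp [this x hx hv], fun y hy hxy => by rw [this x hx hv, this y hy (hxy ▸ hv)]⟩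
    · have := fun z hz => h.rotate.flip.eq_of_fibre hS hn hK (x := z) hz
      exact ⟨by simp [this x hx hv], fun y hy hxy => by rw [this x hx hv, this y hy (hxy ▸ hv)]⟩
    · have := fun z hz => h.rotate.rotate.eq_of_fibre hS hn hK (x := z) hz
      exact ⟨by simp [this x hx hv], fun y hy hxy => by rw [this x hx hv, this y hy (hxy ▸ hv)]⟩
    · have := fun z hz => h.rotate.rotate.flip.eq_of_fibre hS hn hK (x := z) hz
      exact ⟨by simp [this x hx hv], fun y hy hxy => by rw [this x hx hv, this y hy (hxy ▸ hv)]⟩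
    · exact (h.no_extra hS hn hK hall hx hv).elim
    · exact (h.flip.no_extra hS hn hK hall'' hx hv).elim
  have m1 : ∀ p ∈ P, p.1 ∈ entries P := fun p hp =>
    Multiset.mem_add.2 (Or.inl (Multiset.mem_map_of_mem _ hp))
  have m2 : ∀ p ∈ P, p.2 ∈ entries P := fun p hp =>
    Multiset.mem_add.2 (Or.inr (Multiset.mem_map_of_mem _ hp))
  have hdiag : ∀ p ∈ P, p.1 = p.2 := fun p hp =>
    (hall' p.1 (m1 p hp)).2 p.2 (m2 p hp) (h.fibre_eq p hp)
  have r2 := h.add_eq hS hn hK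
  have hPS : entries P ≤ S := by rw [← h.eq]; exact Multiset.le_add_right _ _
  refine ⟨r2, r2.trans (h.rotate.add_eq hS hn hK), P.map Prod.fst,
    by rw [Multiset.card_map, h.card_eq], ?_, ?_, ?_⟩
  · rw [← h.eq, entries, Multiset.map_congr rfl fun p hp => (hdiag p hp).symm]
  · intro x hx
    obtain ⟨p, hp, rfl⟩ := Multiset.mem_map.1 hx
    exact (hall' p.1 (m1 p hp)).1
  · have hpi : π ((s₁ + t₁) + (s₁ + t₁)) = 0 := by rw [map_add, EightGroup.add_self]
    have : Finite π.ker := Nat.finite_of_card_ne_zero (by omega)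
    obtain ⟨a, b, ha, hb, hab, hsum, hT⟩ := subgroup_eq_replicate π.ker (by omega) (pairSums P)
      (pairSums_mem_ker π EightGroup.add_self h.fibre_eq)
      (by rw [card_pairSums, h.card_eq, hK]) (by rw [hK]; exact hS.pairSums hPS)
      ((s₁ + t₁) + (s₁ + t₁)) hpi (by
        intro Z hZ hZc hs
        obtain ⟨Q, hQ, rfl⟩ := exists_le_map_eq _ P Z hZ
        -- Two couples form a plane with sum `2r`, where `r = s₁ + t₁`; hence `-2r` is not a sum of
        -- `n - 2` pair sums.
        refine hS (entries Q + ({s₁} + {t₁} + {s₂} + {t₂})) ?_ ?_ ?_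
        · rw [← h.eq]
          refine add_le_add (entries_le hQ)
            (Multiset.le_iff_exists_add.2 ⟨{s₃} + {t₃}, by abel⟩)
        · rw [Multiset.card_map] at hZc
          rw [Multiset.card_add, card_entries]
          simp
          omega
        · rw [Multiset.sum_add, sum_entries, ← hs]
          nth_rewrite 2 [r2]
          simp only [Multiset.sum_add, Multiset.sum_singleton, pairSums]
          abel)
    rw [hK] at hab hT
    refine ⟨a, b, ha, hb, hab, hsum, ?_⟩
    rw [← hT, pairSums, Multiset.map_map]
    exact Multiset.map_congr rfl fun p hp => by simp [← hdiag p hp]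

end SixFibres

/-! ### Independence and complements of pairs in the group of order eight. -/

/-- The condition that three elements of an elementary abelian `2`-group are independent. -/
def IndepTriple {V : Type*} [AddCommGroup V] (u v w : V) : Prop :=
  u ≠ 0 ∧ v ≠ 0 ∧ w ≠ 0 ∧ u + v ≠ 0 ∧ u + w ≠ 0 ∧ v + w ≠ 0 ∧ u + v + w ≠ 0

instance {V : Type*} [AddCommGroup V] [DecidableEq V] (u v w : V) :
    Decidable (IndepTriple u v w) := by
  unfold IndepTriple; infer_instance

-- The complement of two points is a union of three lines parallel to `d = q - p`. Translating `p`
-- to `0` leaves a check small enough for `decide`. The last two equations identify the missing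
-- fibres with those treated in `SixFibres.no_extra`.
set_option maxRecDepth 10000 in
theorem EightGroup.exists_compl_pair (p q : EightGroup) (hpq : p ≠ q) :
    ∃ x₁ x₂ x₃ d : EightGroup, ({p, q} : Finset EightGroup)ᶜ.val =
      {x₁, x₁ + d, x₂, x₂ + d, x₃, x₃ + d} ∧ p = x₁ + x₂ + x₃ ∧ q = x₁ + d + x₂ + x₃ := by
  have key : ∀ q : EightGroup, 0 ≠ q → ∃ x₁ x₂, ({0, q} : Finset EightGroup)ᶜ.val =
      {x₁, x₁ + q, x₂, x₂ + q, x₁ + x₂, x₁ + x₂ + q} := by decide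
  obtain ⟨x₁, x₂, h⟩ := key (q - p) (fun h => hpq (sub_eq_zero.1 h.symm).symm)
  have h2 := EightGroup.two_eq_zero
  refine ⟨x₁ + p, x₂ + p, x₁ + x₂ + p, q - p, ?_, ?_, ?_⟩
  · have h3 := congrArg (Multiset.map (· + p)) h
    have h4 : ({p, q} : Finset EightGroup)ᶜ = ({0, q - p} : Finset EightGroup)ᶜ.map
        (addRightEmbedding p) := by
      ext z
      simp only [Finset.mem_compl, Finset.mem_insert, Finset.mem_singleton, Finset.mem_map,
        addRightEmbedding_apply]
      constructor
      · intro hz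
        refine ⟨z - p, ?_, by abel⟩
        rintro (h | h)
        · exact hz (Or.inl (sub_eq_zero.1 h))
        · exact hz (Or.inr (sub_left_injective h))
      · rintro ⟨w, hw, rfl⟩ (h | h)
        · exact hw (Or.inl (by simpa using h))
        · exact hw (Or.inr (eq_sub_of_add_eq h))
    rw [h4, Finset.map_val]
    refine h3.trans ?_
    simp only [Multiset.insert_eq_cons, Multiset.map_cons, Multiset.map_singleton]
    congr 1
    rw [show x₁ + (q - p) + p = x₁ + p + (q - p) by abel,
      show x₂ + (q - p) + p = x₂ + p + (q - p) by abel,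
      show x₁ + x₂ + (q - p) + p = x₁ + x₂ + p + (q - p) by abel]
  · linear_combination -(x₁ + x₂ + p) * h2
  · linear_combination -(x₁ + x₂ + p) * h2

/-! ### Structure at length `4n + 2`, and impossibility of length `4n + 3`. -/

section Structure

variable {G : Type*} [AddCommGroup G] {n : ℕ} {π : G →+ EightGroup}

/-- The structure of a sequence of length `4n + 2` without zero-sum subsequence of length `2n`. -/
theorem exists_structure (hn : 2 ≤ n) (hK : Nat.card π.ker = n) [IsAddCyclic π.ker]
    {S : Multiset G} (hS : NoZeroSum (2 * n) S) (hSc : S.card = 4 * n + 2) :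
    ∃ s₁ t₁ s₂ t₂ s₃ t₃ : G, ∃ d : EightGroup, ∃ M : Multiset G, ∃ a b : G,
      (({s₁} + {t₁} + {s₂} + {t₂} + {s₃} + {t₃} : Multiset G).map π).Nodup ∧
      π t₁ = π s₁ + d ∧ π t₂ = π s₂ + d ∧ π t₃ = π s₃ + d ∧
      s₁ + t₁ = s₂ + t₂ ∧ s₁ + t₁ = s₃ + t₃ ∧ M.card = 2 * n - 2 ∧
      S = M + M + ({s₁} + {t₁} + {s₂} + {t₂} + {s₃} + {t₃}) ∧
      (∀ x ∈ M, x = s₁ ∨ x = t₁ ∨ x = s₂ ∨ x = t₂ ∨ x = s₃ ∨ x = t₃) ∧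
      a ∈ π.ker ∧ b ∈ π.ker ∧ addOrderOf (b - a) = n ∧ (s₁ + t₁) + (s₁ + t₁) = a + b ∧
        M.map (fun x => x + x) =
          Multiset.replicate (n - 1) a + Multiset.replicate (n - 1) b := by
  have : Finite π.ker := Nat.finite_of_card_ne_zero (by omega)
  obtain ⟨P, U, hPU, hP, hU⟩ := exists_pairing π S
  obtain ⟨s, W, rfl, hs⟩ := exists_section π U hU
  have hc : 2 * P.card + W.card = 4 * n + 2 := by
    rw [← hSc, hPU, Multiset.card_add, card_entries, Multiset.card_map]
    rfl
  have hW : W.card ≤ 8 := W.card_le_univ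
  have hPS : entries P ≤ S := by rw [hPU]; exact Multiset.le_add_right _ _
  have hPc : P.card ≤ 2 * n - 2 := by
    by_contra hlt
    obtain ⟨Z, hZ, hZc, hZs⟩ := subgroup_exists_zero_sum π.ker (pairSums P)
      (pairSums_mem_ker π EightGroup.add_self hP) (by rw [card_pairSums, hK]; omega)
    exact hS.pairSums hPS Z hZ (hZc.trans hK) hZs
  -- At most `2n - 2` pairs leave at least six unpaired terms, and `|W|` is even and at most eight.
  rcases (by omega : W.card = 8 ∨ W.card = 6) with h8 | h6
  · exfalso
    have hWu : W = Finset.univ := Finset.eq_univ_of_card W h8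
    subst hWu
    exact false_of_eight_fibres π hn hK hS hP (by omega) s (fun v => hs v (Finset.mem_univ v))
      hPU.ge
  · have h2 : Wᶜ.card = 2 := by
      rw [Finset.card_compl, h6]
      rfl
    obtain ⟨p, q, hpq, hWpq⟩ := Finset.card_eq_two.1 h2
    obtain ⟨x₁, x₂, x₃, d, hx, hp, hq⟩ := EightGroup.exists_compl_pair p q hpq
    have hWx : W.val = {x₁, x₁ + d, x₂, x₂ + d, x₃, x₃ + d} := by
      rw [← hx, ← hWpq, compl_compl]
    have hmem : ∀ v, v ∈ W ↔ v = x₁ ∨ v = x₁ + d ∨ v = x₂ ∨ v = x₂ + d ∨ v = x₃ ∨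
        v = x₃ + d := by
      intro v
      rw [← Finset.mem_val, hWx]
      simp
    have hUs : W.val.map s =
        {s x₁} + {s (x₁ + d)} + {s x₂} + {s (x₂ + d)} + {s x₃} + {s (x₃ + d)} := by
      rw [hWx]
      simp only [Multiset.insert_eq_cons, ← Multiset.singleton_add, Multiset.map_add,
        Multiset.map_singleton]
      abel
    have e1 := hs x₁ ((hmem _).2 (by simp))
    have e2 := hs x₂ ((hmem _).2 (by simp))
    have e3 := hs x₃ ((hmem _).2 (by simp))
    have g1 := hs (x₁ + d) ((hmem _).2 (by simp))
    have g2 := hs (x₂ + d) ((hmem _).2 (by simp))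
    have g3 := hs (x₃ + d) ((hmem _).2 (by simp))
    rw [hUs] at hPU hU
    have hsix : SixFibres π n S P d (s x₁) (s (x₁ + d)) (s x₂) (s (x₂ + d)) (s x₃) (s (x₃ + d)) :=
      ⟨hP, by omega, hPU.symm, by rw [e1, g1], by rw [e2, g2], by rw [e3, g3]⟩
    obtain ⟨r2, r3, M, hMc, hSM, hM, a, b, ha, hb, hab, hr, hT⟩ :=
      hsix.structure_eq hS hn hK (by
        intro v
        rw [e1, e2, e3, g1, g2, g3, ← hp, ← hq]
        by_cases hv : v ∈ W
        · have := (hmem v).1 hv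
          tauto
        · have : v ∈ Wᶜ := Finset.mem_compl.2 hv
          rw [hWpq] at this
          simp only [Finset.mem_insert, Finset.mem_singleton] at this
          tauto)
    exact ⟨_, _, _, _, _, _, d, M, a, b, hU, hsix.diff₁, hsix.diff₂, hsix.diff₃, r2, r3, hMc, hSM,
      hM, ha, hb, hab, hr, hT⟩

/-- There are no sequences of length `4n + 3` without zero-sum subsequence of length `2n`. -/
theorem card_ne_of_noZeroSum (hn : 2 ≤ n) (hK : Nat.card π.ker = n) [IsAddCyclic π.ker]
    {S : Multiset G} (hS : NoZeroSum (2 * n) S) : S.card ≠ 4 * n + 3 := by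
  classical
  intro hSc
  -- After deletion of any `x` the rest is `M + M` and six terms in distinct fibres, these being the
  -- only occupied ones, so each occupied fibre has odd multiplicity.
  have key : ∀ x ∈ S, (∀ v ∈ (S.map π).erase (π x), Odd (((S.map π).erase (π x)).count v)) ∧
      ∃ y ∈ S, π y ≠ π x := by
    intro x hx
    obtain ⟨S, rfl⟩ := Multiset.exists_cons_of_mem hx
    obtain ⟨s₁, t₁, s₂, t₂, s₃, t₃, d, M, a, b, hnd, -, -, -, -, -, -, hSM, hM, -⟩ :=
      exists_structure (π := π) (S := S) hn hK
        (fun Z hZ => hS Z (hZ.trans (Multiset.le_cons_self _ _)))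
        (by rw [Multiset.card_cons] at hSc; omega)
    set U : Multiset G := {s₁} + {t₁} + {s₂} + {t₂} + {s₃} + {t₃} with hU
    have hMU : ∀ z ∈ M, z ∈ U := by
      intro z hz
      have := hM z hz
      simp only [hU, Multiset.mem_add, Multiset.mem_singleton]
      tauto
    constructor
    · rw [Multiset.map_cons, Multiset.erase_cons_head, hSM]
      intro v hv
      have hvU : v ∈ U.map π := by
        obtain ⟨z, hz, rfl⟩ := Multiset.mem_map.1 hv
        apply Multiset.mem_map_of_mem
        rcases Multiset.mem_add.1 hz with hz | hz
        · rcases Multiset.mem_add.1 hz with hz | hz <;> exact hMU z hz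
        · exact hz
      rw [Multiset.map_add, Multiset.map_add, Multiset.count_add, Multiset.count_add,
        Multiset.count_eq_one_of_mem hnd hvU, ← two_mul]
      exact odd_two_mul_add_one _
    · have h1 : s₁ ∈ S := by rw [hSM]; simp [hU]
      have h2 : t₁ ∈ S := by rw [hSM]; simp [hU]
      have hne : π s₁ ≠ π t₁ := by
        intro h
        simp only [hU, Multiset.map_add, Multiset.map_singleton, h, add_assoc] at hnd
        rw [Multiset.singleton_add] at hnd
        exact (Multiset.nodup_cons.1 hnd).1 (by simp)
      by_cases hs : π s₁ = π x
      · exact ⟨t₁, Multiset.mem_cons_of_mem h2, fun h => hne (hs.trans h.symm)⟩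
      · exact ⟨s₁, Multiset.mem_cons_of_mem h1, hs⟩
  have hnd : ¬ (S.map π).Nodup := by
    intro h
    have := Finset.card_le_univ (⟨S.map π, h⟩ : Finset EightGroup)
    have h8 : Fintype.card EightGroup = 8 := rfl
    simp only [Finset.card_mk, Multiset.card_map, hSc, h8] at this
    omega
  rw [Multiset.nodup_iff_count_le_one] at hnd
  push Not at hnd
  obtain ⟨v, hv⟩ := hnd
  have hvS : v ∈ S.map π := Multiset.count_pos.1 (by omega)
  obtain ⟨x, hx, rfl⟩ := Multiset.mem_map.1 hvS
  obtain ⟨hodd, y, hy, hyx⟩ := key x hx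
  -- Deleting `x` from its fibre, which holds at least two terms, makes the multiplicity odd;
  -- deleting `y` from another fibre leaves it as it was, again odd. These numbers differ by one.
  have h1 := hodd (π x) (by rw [← Multiset.count_pos, Multiset.count_erase_self]; omega)
  rw [Multiset.count_erase_self] at h1
  have h2 := (key y hy).1 (π x)
    (by rw [← Multiset.count_pos, Multiset.count_erase_of_ne hyx.symm]; omega)
  rw [Multiset.count_erase_of_ne hyx.symm] at h2
  obtain ⟨i, hi⟩ := h1
  obtain ⟨j, hj⟩ := h2
  omega

end Structure

/-! ### Recognising a basis from its image modulo `2G`. -/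

section Basis

variable {G : Type*} [AddCommGroup G] {n : ℕ} {π : G →+ EightGroup}

set_option maxRecDepth 10000 in
theorem IndepTriple.span : ∀ u v w : EightGroup, IndepTriple u v w → ∀ x : EightGroup,
    x = 0 ∨ x = u ∨ x = v ∨ x = w ∨ x = u + v ∨ x = u + w ∨ x = v + w ∨ x = u + v + w := by
  decide

theorem exists_nsmul_eq (hn : 2 ≤ n) (hK : Nat.card π.ker = n) {g x : G} (hg : π g = 0)
    (hgn : addOrderOf g = n) (hx : π x = 0) : ∃ j < n, x = j • g := by
  have : Finite π.ker := Nat.finite_of_card_ne_zero (by omega)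
  have hle : AddSubgroup.zmultiples g ≤ π.ker := by
    rw [AddSubgroup.zmultiples_le]; exact hg
  have heq : AddSubgroup.zmultiples g = π.ker :=
    AddSubgroup.eq_of_le_of_card_ge hle (by rw [hK, Nat.card_zmultiples, hgn])
  have hx' : x ∈ AddSubgroup.zmultiples g := by rw [heq]; exact hx
  have hfin : IsOfFinAddOrder g := addOrderOf_pos_iff.1 (by omega)
  classical
  rw [hfin.mem_zmultiples_iff_mem_range_addOrderOf, Finset.mem_image] at hx'
  obtain ⟨j, hj, hjx⟩ := hx'
  exact ⟨j, by simpa [hgn] using hj, hjx.symm⟩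

theorem map_zsmul_even (π : G →+ EightGroup) (f : G) {j : ℤ} (hj : Even j) : π (j • f) = 0 := by
  obtain ⟨i, rfl⟩ := hj
  rw [add_smul, map_add, EightGroup.add_self]

theorem map_zsmul_odd (π : G →+ EightGroup) (f : G) {j : ℤ} (hj : ¬ Even j) :
    π (j • f) = π f := by
  obtain ⟨i, rfl⟩ := Int.not_even_iff_odd.1 hj
  rw [add_smul, map_add, map_zsmul_even π f (even_two_mul i), one_smul, zero_add]

/-- A relation must have even coefficients by independence in `C₂³`, which settles `f₁` and `f₂`.
For generation, the images span `C₂³` and `2f₃`, of order `n`, generates `ker π`. -/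
theorem isBasis_of_indepTriple (hn : 2 ≤ n) (hK : Nat.card π.ker = n) {f₁ f₂ f₃ : G}
    (h1 : f₁ + f₁ = 0) (h2 : f₂ + f₂ = 0) (h3 : addOrderOf (f₃ + f₃) = n)
    (hind : IndepTriple (π f₁) (π f₂) (π f₃)) : IsBasis n f₁ f₂ f₃ := by
  have hn0 : n • (f₃ + f₃) = 0 := by rw [← h3, addOrderOf_nsmul_eq_zero]
  have two : ∀ f : G, f + f = 0 → ∀ j : ℤ, Even j → j • f = 0 := by
    rintro f hf j ⟨i, rfl⟩
    rw [add_smul, ← smul_add, hf, smul_zero]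
  have heven : ∀ j₁ j₂ j₃ : ℤ, π (j₁ • f₁ + j₂ • f₂ + j₃ • f₃) = 0 →
      Even j₁ ∧ Even j₂ ∧ Even j₃ := by
    intro j₁ j₂ j₃ h
    rw [map_add, map_add] at h
    obtain ⟨k1, k2, k3, k4, k5, k6, k7⟩ := hind
    by_cases c1 : Even j₁ <;> by_cases c2 : Even j₂ <;> by_cases c3 : Even j₃ <;>
      simp only [map_zsmul_even π, map_zsmul_odd π, c1, c2, c3, not_false_eq_true, zero_add,
        add_zero] at h <;> simp_all
  have ord2 : ∀ f : G, f + f = 0 → π f ≠ 0 → addOrderOf f = 2 := by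
    intro f hf hπ
    refine addOrderOf_eq_prime (by rw [two_nsmul, hf]) ?_
    rintro rfl
    exact hπ (map_zero π)
  refine ⟨?_, ?_, ord2 f₁ h1 hind.1, ord2 f₂ h2 hind.2.1, ?_⟩
  · intro j₁ j₂ j₃ h
    obtain ⟨c1, c2, c3⟩ := heven j₁ j₂ j₃ (by rw [h, map_zero])
    have z1 := two f₁ h1 j₁ c1
    have z2 := two f₂ h2 j₂ c2
    refine ⟨z1, z2, ?_⟩
    simpa [z1, z2] using h
  · rw [eq_top_iff]
    intro g _
    set C := AddSubgroup.closure ({f₁, f₂, f₃} : Set G) with hC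
    have m1 : f₁ ∈ C := AddSubgroup.subset_closure (by simp)
    have m2 : f₂ ∈ C := AddSubgroup.subset_closure (by simp)
    have m3 : f₃ ∈ C := AddSubgroup.subset_closure (by simp)
    have hcos : ∀ f ∈ C, π g = π f → g ∈ C := by
      intro f hf hgf
      obtain ⟨j, -, hj⟩ := exists_nsmul_eq hn hK (x := g - f)
        (by rw [map_add, EightGroup.add_self]) h3 (by rw [map_sub, hgf, sub_self])
      have : g - f ∈ C := by rw [hj]; exact C.nsmul_mem (C.add_mem m3 m3) j
      simpa using C.add_mem this hf
    rcases hind.span _ _ _ (π g) with h | h | h | h | h | h | h | h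
    · exact hcos 0 C.zero_mem (by rw [h, map_zero])
    · exact hcos _ m1 h
    · exact hcos _ m2 h
    · exact hcos _ m3 h
    · exact hcos (f₁ + f₂) (C.add_mem m1 m2) (by rw [h, map_add])
    · exact hcos (f₁ + f₃) (C.add_mem m1 m3) (by rw [h, map_add])
    · exact hcos (f₂ + f₃) (C.add_mem m2 m3) (by rw [h, map_add])
    · exact hcos (f₁ + f₂ + f₃) (C.add_mem (C.add_mem m1 m2) m3) (by rw [h, map_add, map_add])
  · rw [addOrderOf_eq_iff (by omega)]
    refine ⟨by rw [mul_comm, mul_nsmul', two_nsmul, hn0], ?_⟩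
    intro m hm hm0 hmf
    have hmf' : (0 : ℤ) • f₁ + (0 : ℤ) • f₂ + (m : ℤ) • f₃ = 0 := by simpa using hmf
    obtain ⟨-, -, c⟩ := heven 0 0 m (by rw [hmf', map_zero])
    obtain ⟨i, hi⟩ := (Int.even_coe_nat m).1 c
    have : i • (f₃ + f₃) = 0 := by rw [smul_add, ← add_smul, ← hi, hmf]
    have hdvd := addOrderOf_dvd_of_nsmul_eq_zero this
    rw [h3] at hdvd
    have := Nat.le_of_dvd (by omega) hdvd
    omega

end Basis

theorem exists_replicate_of_mem {B : Type*} (s₁ t₁ s₂ t₂ s₃ t₃ : B) (M : Multiset B)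
    (hM : ∀ x ∈ M, x = s₁ ∨ x = t₁ ∨ x = s₂ ∨ x = t₂ ∨ x = s₃ ∨ x = t₃) :
    ∃ m₁ k₁ m₂ k₂ m₃ k₃ : ℕ, M = Multiset.replicate m₁ s₁ + Multiset.replicate k₁ t₁
      + (Multiset.replicate m₂ s₂ + Multiset.replicate k₂ t₂)
      + (Multiset.replicate m₃ s₃ + Multiset.replicate k₃ t₃) := by
  induction M using Multiset.induction_on with
  | empty => exact ⟨0, 0, 0, 0, 0, 0, by simp⟩
  | cons x M ih =>
    obtain ⟨m₁, k₁, m₂, k₂, m₃, k₃, rfl⟩ := ih fun y hy => hM y (Multiset.mem_cons_of_mem hy)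
    have hsucc : ∀ (m : ℕ) (y : B), Multiset.replicate (m + 1) y
        = {y} + Multiset.replicate m y := fun m y => by
      rw [Multiset.replicate_succ, Multiset.singleton_add]
    rw [← Multiset.singleton_add]
    rcases hM x (Multiset.mem_cons_self _ _) with rfl | rfl | rfl | rfl | rfl | rfl
    · exact ⟨m₁ + 1, k₁, m₂, k₂, m₃, k₃, by rw [hsucc]; abel⟩
    · exact ⟨m₁, k₁ + 1, m₂, k₂, m₃, k₃, by rw [hsucc]; abel⟩
    · exact ⟨m₁, k₁, m₂ + 1, k₂, m₃, k₃, by rw [hsucc]; abel⟩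
    · exact ⟨m₁, k₁, m₂, k₂ + 1, m₃, k₃, by rw [hsucc]; abel⟩
    · exact ⟨m₁, k₁, m₂, k₂, m₃ + 1, k₃, by rw [hsucc]; abel⟩
    · exact ⟨m₁, k₁, m₂, k₂, m₃, k₃ + 1, by rw [hsucc]; abel⟩

/-! ### From three couples to the forms (s1), (s2), (s3). -/

section Classification

variable {G : Type*} [AddCommGroup G] {n : ℕ} {π : G →+ EightGroup}

/-- A sequence composed of six elements with odd multiplicities, that form three pairs with the same
sum `r`, such that one half of the sequence, doubled, consists of `a` and `b` in equal numbers. -/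
structure Blocks (π : G →+ EightGroup) (n : ℕ) (S : Multiset G) (a b r s₁ s₂ s₃ : G)
    (m₁ k₁ m₂ k₂ m₃ k₃ : ℕ) : Prop where
  eq : S = Multiset.replicate (2 * m₁ + 1) s₁ + Multiset.replicate (2 * k₁ + 1) (r - s₁)
    + (Multiset.replicate (2 * m₂ + 1) s₂ + Multiset.replicate (2 * k₂ + 1) (r - s₂))
    + (Multiset.replicate (2 * m₃ + 1) s₃ + Multiset.replicate (2 * k₃ + 1) (r - s₃))
  indep : IndepTriple (π s₁ + π s₂) (π s₁ + π s₃) (π r)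
  map_a : π a = 0
  map_b : π b = 0
  order : addOrderOf (b - a) = n
  two_r : r + r = a + b
  halves : Multiset.replicate m₁ (s₁ + s₁) + Multiset.replicate k₁ (r - s₁ + (r - s₁))
    + (Multiset.replicate m₂ (s₂ + s₂) + Multiset.replicate k₂ (r - s₂ + (r - s₂)))
    + (Multiset.replicate m₃ (s₃ + s₃) + Multiset.replicate k₃ (r - s₃ + (r - s₃)))
    = Multiset.replicate (n - 1) a + Multiset.replicate (n - 1) b

theorem IndepTriple.flip : ∀ {u v w : EightGroup}, IndepTriple u v w →
    IndepTriple (u + w) (v + w) w := by decide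

theorem IndepTriple.rotate : ∀ {u v w : EightGroup}, IndepTriple u v w →
    IndepTriple (u + v) u w := by decide

theorem IndepTriple.add_left : ∀ {u v w : EightGroup}, IndepTriple u v w →
    IndepTriple v u (w + u) := by decide

theorem IndepTriple.add_snd : ∀ {u v w : EightGroup}, IndepTriple u v w →
    IndepTriple u (v + w) w := by decide

theorem IndepTriple.symm : ∀ {u v w : EightGroup}, IndepTriple u v w →
    IndepTriple v u w := by decide

/-- Independence is preserved if a multiple of one element is subtracted from another one. -/
theorem IndepTriple.sub_nsmul {v w : G} {u : EightGroup} (h : IndepTriple u (π v) (π w)) (j : ℕ) :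
    IndepTriple u (π (v - j • w)) (π w) := by
  have h2 : ∀ x : EightGroup, -x = x := by decide
  rw [map_sub, sub_eq_add_neg, h2, ← natCast_zsmul]
  by_cases hj : Even (j : ℤ)
  · rwa [map_zsmul_even π w hj, add_zero]
  · rw [map_zsmul_odd π w hj]
    exact h.add_snd

variable {S : Multiset G} {a b r s₁ s₂ s₃ : G} {m₁ k₁ m₂ k₂ m₃ k₃ : ℕ}

theorem Blocks.flip (h : Blocks π n S a b r s₁ s₂ s₃ m₁ k₁ m₂ k₂ m₃ k₃) :
    Blocks π n S a b r (r - s₁) s₂ s₃ k₁ m₁ m₂ k₂ m₃ k₃ where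
  eq := by rw [h.eq, sub_sub_cancel]; abel
  indep := by
    have h2 := EightGroup.two_eq_zero
    convert h.indep.flip using 1 <;> rw [map_sub] <;> linear_combination -(π s₁) * h2
  map_a := h.map_a
  map_b := h.map_b
  order := h.order
  two_r := h.two_r
  halves := by rw [← h.halves, sub_sub_cancel]; abel

theorem Blocks.rotate (h : Blocks π n S a b r s₁ s₂ s₃ m₁ k₁ m₂ k₂ m₃ k₃) :
    Blocks π n S a b r s₂ s₃ s₁ m₂ k₂ m₃ k₃ m₁ k₁ where
  eq := by rw [h.eq]; abel
  indep := by
    have h2 := EightGroup.two_eq_zero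
    convert h.indep.rotate using 1
    · linear_combination -(π s₁) * h2
    · ring
  map_a := h.map_a
  map_b := h.map_b
  order := h.order
  two_r := h.two_r
  halves := by rw [← h.halves]; abel

theorem Blocks.ne (hn : 2 ≤ n) (h : Blocks π n S a b r s₁ s₂ s₃ m₁ k₁ m₂ k₂ m₃ k₃) : a ≠ b := by
  rintro rfl
  have := h.order
  simp at this
  omega

/-- After a flip, `2 s₁ = a` or `s₁` occurs only once. -/
theorem Blocks.normalize (h : Blocks π n S a b r s₁ s₂ s₃ m₁ k₁ m₂ k₂ m₃ k₃) :
    ∃ s m k, Blocks π n S a b r s s₂ s₃ m k m₂ k₂ m₃ k₃ ∧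
      (s + s = a ∨ s + s ≠ a ∧ s + s ≠ b ∧ m = 0 ∧ k = 0) := by
  by_cases ha : s₁ + s₁ = a
  · exact ⟨s₁, m₁, k₁, h, Or.inl ha⟩
  by_cases hb : s₁ + s₁ = b
  · exact ⟨r - s₁, k₁, m₁, h.flip, Or.inl (by
      linear_combination (norm := module) h.two_r - hb)⟩
  refine ⟨s₁, m₁, k₁, h, Or.inr ⟨ha, hb, ?_, ?_⟩⟩
  · by_contra hm
    have : s₁ + s₁ ∈ Multiset.replicate (n - 1) a + Multiset.replicate (n - 1) b := by
      rw [← h.halves]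
      simp [Multiset.mem_replicate, hm]
    simp only [Multiset.mem_add, Multiset.mem_replicate] at this
    tauto
  · by_contra hm
    have : r - s₁ + (r - s₁) ∈ Multiset.replicate (n - 1) a + Multiset.replicate (n - 1) b := by
      rw [← h.halves]
      simp [Multiset.mem_replicate, hm]
    simp only [Multiset.mem_add, Multiset.mem_replicate] at this
    rcases this with ⟨-, h1⟩ | ⟨-, h1⟩
    · exact hb (by linear_combination (norm := module) h.two_r - h1)
    · exact ha (by linear_combination (norm := module) h.two_r - h1)

theorem translate_replicate (f x : G) (m : ℕ) :
    translate f (Multiset.replicate m x) = Multiset.replicate m (f + x) := by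
  simp [translate]

theorem translate_add (f : G) (S T : Multiset G) :
    translate f (S + T) = translate f S + translate f T := by
  simp [translate]

/-- The case where all three pairs have doubles `a`, `b`. -/
theorem Blocks.formS3 (hn : 2 ≤ n) (hK : Nat.card π.ker = n)
    (h : Blocks π n S a b r s₁ s₂ s₃ m₁ k₁ m₂ k₂ m₃ k₃)
    (h1 : s₁ + s₁ = a) (h2 : s₂ + s₂ = a) (h3 : s₃ + s₃ = a) :
    ∃ f₁ f₂ f₃ f : G, IsBasis n f₁ f₂ f₃ ∧ FormS3 n f₁ f₂ f₃ (translate (-f) S) := by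
  classical
  have hab := h.ne hn
  have t1 : r - s₁ + (r - s₁) = b := by linear_combination (norm := module) h.two_r - h1
  have t2 : r - s₂ + (r - s₂) = b := by linear_combination (norm := module) h.two_r - h2
  have t3 : r - s₃ + (r - s₃) = b := by linear_combination (norm := module) h.two_r - h3
  have hcount := h.halves
  rw [h1, h2, h3, t1, t2, t3] at hcount
  have ca := congrArg (Multiset.count a) hcount
  have cb := congrArg (Multiset.count b) hcount
  simp [Multiset.count_replicate, hab, hab.symm] at ca cb
  have z1 : (s₂ - s₁) + (s₂ - s₁) = 0 := by linear_combination (norm := module) h2 - h1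
  have z2 : (s₃ - s₁) + (s₃ - s₁) = 0 := by linear_combination (norm := module) h3 - h1
  have z3 : (r - s₁ - s₁) + (r - s₁ - s₁) = b - a := by
    linear_combination (norm := module) t1 - h1
  have htwo := EightGroup.two_eq_zero
  have hind : IndepTriple (π (s₂ - s₁)) (π (s₃ - s₁)) (π (r - s₁ - s₁)) := by
    convert h.indep using 1
    · rw [map_sub]; linear_combination -(π s₁) * htwo
    · rw [map_sub]; linear_combination -(π s₁) * htwo
    · rw [map_sub, map_sub]; linear_combination -(π s₁) * htwo
  have hbasis := isBasis_of_indepTriple hn hK z1 z2 (by rw [z3]; exact h.order) hind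
  -- Translation by `-s₁` sends `sᵢ` to `0, f₁, f₂` and `r - sᵢ` to `f₃ + dᵢ` with `dᵢ = 0, f₁, f₂`.
  -- Odd multiplicities give `σ(D) = f₁ + f₂`, which is none of these; counting `a` gives `m₁ + m₂ +
  -- m₃ = n - 1`.
  refine ⟨s₂ - s₁, s₃ - s₁, r - s₁ - s₁, s₁, hbasis, m₁, m₂, m₃,
    Multiset.replicate (2 * k₁ + 1) 0 + Multiset.replicate (2 * k₂ + 1) (s₂ - s₁)
      + Multiset.replicate (2 * k₃ + 1) (s₃ - s₁), by omega, by omega, by omega, by omega, ?_, ?_,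
      ?_, ?_⟩
  · simp only [Multiset.card_add, Multiset.card_replicate]
    omega
  · intro d hd
    simp only [Multiset.mem_add, Multiset.mem_replicate] at hd
    rcases hd with (⟨-, rfl⟩ | ⟨-, rfl⟩) | ⟨-, rfl⟩
    · exact zero_mem _
    · exact AddSubgroup.subset_closure (by simp)
    · exact AddSubgroup.subset_closure (by simp)
  · have hs : (Multiset.replicate (2 * k₁ + 1) 0 + Multiset.replicate (2 * k₂ + 1) (s₂ - s₁)
      + Multiset.replicate (2 * k₃ + 1) (s₃ - s₁)).sum = (s₂ - s₁) + (s₃ - s₁) := by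
      simp only [Multiset.sum_add, Multiset.sum_replicate, smul_zero, zero_add]
      linear_combination (norm := module) (k₂ : ℤ) • z1 + (k₃ : ℤ) • z2
    rw [hs]
    intro hd
    simp only [Multiset.mem_add, Multiset.mem_replicate] at hd
    obtain ⟨i1, i2, -, i12, -⟩ := hind
    rcases hd with (⟨-, hd⟩ | ⟨-, hd⟩) | ⟨-, hd⟩
    · exact i12 (by rw [← map_add, hd, map_zero])
    · exact i2 (by rw [show s₃ - s₁ = 0 by simpa using hd, map_zero])
    · exact i1 (by rw [show s₂ - s₁ = 0 by simpa using hd, map_zero])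
  · rw [h.eq]
    simp only [translate_add, translate_replicate, Multiset.map_add, Multiset.map_replicate]
    rw [show -s₁ + s₁ = 0 by abel, show -s₁ + (r - s₁) = r - s₁ - s₁ + 0 by abel,
      show -s₁ + s₂ = s₂ - s₁ by abel, show -s₁ + s₃ = s₃ - s₁ by abel,
      show -s₁ + (r - s₂) = r - s₁ - s₁ + (s₂ - s₁) by linear_combination (norm := module) -z1,
      show -s₁ + (r - s₃) = r - s₁ - s₁ + (s₃ - s₁) by linear_combination (norm := module) -z2]
    abel

/-- An element whose double is neither `a` nor `b`, up to an element of order two. -/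
theorem Blocks.exists_nsmul (hn : 2 ≤ n) (hK : Nat.card π.ker = n)
    (h : Blocks π n S a b r s₁ s₂ s₃ m₁ k₁ m₂ k₂ m₃ k₃)
    (h1 : s₁ + s₁ = a) {x : G} (hxa : x + x ≠ a) (hxb : x + x ≠ b) {f₃ : G} (hf : f₃ + f₃ = b - a) :
    ∃ j : ℕ, 2 ≤ j ∧ j < n ∧ (x - s₁ - j • f₃) + (x - s₁ - j • f₃) = 0 := by
  obtain ⟨j, hj, hjx⟩ := exists_nsmul_eq hn hK (g := b - a) (x := x - s₁ + (x - s₁))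
    (by rw [map_sub, h.map_a, h.map_b, sub_zero]) h.order
    (by rw [map_add, EightGroup.add_self])
  refine ⟨j, ?_, hj, ?_⟩
  · by_contra hlt
    rcases (by omega : j = 0 ∨ j = 1) with rfl | rfl
    · exact hxa (by rw [zero_smul] at hjx; linear_combination (norm := module) hjx + h1)
    · exact hxb (by rw [one_smul] at hjx; linear_combination (norm := module) hjx + h1)
  · have : j • f₃ + j • f₃ = j • (b - a) := by rw [← smul_add, hf]
    linear_combination (norm := module) hjx - this

/-- The case where two of the three pairs have doubles `a`, `b`. -/
theorem Blocks.formS1 (hn : 2 ≤ n) (hK : Nat.card π.ker = n)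
    (h : Blocks π n S a b r s₁ s₂ s₃ m₁ k₁ m₂ k₂ 0 0)
    (h1 : s₁ + s₁ = a) (h2 : s₂ + s₂ = a) (h3a : s₃ + s₃ ≠ a) (h3b : s₃ + s₃ ≠ b) :
    ∃ f₁ f₂ f₃ f : G, IsBasis n f₁ f₂ f₃ ∧ FormS1 n f₁ f₂ f₃ (translate (-f) S) := by
  classical
  have hab := h.ne hn
  have t1 : r - s₁ + (r - s₁) = b := by linear_combination (norm := module) h.two_r - h1
  have t2 : r - s₂ + (r - s₂) = b := by linear_combination (norm := module) h.two_r - h2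
  have hcount := h.halves
  rw [h1, h2, t1, t2] at hcount
  have ca := congrArg (Multiset.count a) hcount
  have cb := congrArg (Multiset.count b) hcount
  simp [Multiset.count_replicate, hab, hab.symm] at ca cb
  have z2 : (s₂ - s₁) + (s₂ - s₁) = 0 := by linear_combination (norm := module) h2 - h1
  have z3 : (r - s₁ - s₂) + (r - s₁ - s₂) = b - a := by
    linear_combination (norm := module) t1 - h2
  obtain ⟨j, hj2, hjn, z1⟩ := h.exists_nsmul hn hK h1 h3a h3b z3
  have htwo := EightGroup.two_eq_zero
  have hind : IndepTriple (π (s₂ - s₁)) (π (s₃ - s₁)) (π (r - s₁ - s₂)) := by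
    convert h.indep.add_left.symm using 1
    · rw [map_sub]; linear_combination -(π s₁) * htwo
    · rw [map_sub]; linear_combination -(π s₁) * htwo
    · rw [map_sub, map_sub]; linear_combination -(π s₁ + π s₂) * htwo
  have hbasis := isBasis_of_indepTriple hn hK z1 z2 (by rw [z3]; exact h.order)
    (hind.sub_nsmul j).symm
  -- With `f₃ = r - s₁ - s₂`, the terms `r - s₂` and `r - s₁` become `f₃` and `f₃ + f₂`. Subtracting
  -- `j f₃` from `s₃ - s₁` makes `f₁` of order two, and `j` becomes the parameter of the form.
  refine ⟨s₃ - s₁ - j • (r - s₁ - s₂), s₂ - s₁, r - s₁ - s₂, s₁, hbasis, m₁, k₁, j, by omega,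
    by omega, by omega, by omega, ?_⟩
  rw [h.eq]
  simp only [translate_add, translate_replicate]
  rw [show 2 * n - 2 * m₁ - 1 = 2 * m₂ + 1 by omega, show 2 * n - 1 - 2 * k₁ = 2 * k₂ + 1 by omega,
    show -s₁ + s₁ = 0 by abel, show -s₁ + (r - s₂) = r - s₁ - s₂ by abel,
    show -s₁ + s₂ = s₂ - s₁ by abel,
    show -s₁ + (r - s₁) = r - s₁ - s₂ + (s₂ - s₁) by abel,
    show -s₁ + s₃ = (j : ℤ) • (r - s₁ - s₂) + (s₃ - s₁ - j • (r - s₁ - s₂)) by module,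
    show -s₁ + (r - s₃) = (1 - (j : ℤ)) • (r - s₁ - s₂) + (s₂ - s₁)
      + (s₃ - s₁ - j • (r - s₁ - s₂)) by linear_combination (norm := module) -z1]
  simp only [mul_zero, zero_add, Multiset.replicate_one]
  abel

/-- The case where only one of the three pairs has doubles `a`, `b`. -/
theorem Blocks.formS2 (hn : 2 ≤ n) (hK : Nat.card π.ker = n)
    (h : Blocks π n S a b r s₁ s₂ s₃ m₁ k₁ 0 0 0 0)
    (h1 : s₁ + s₁ = a) (h2a : s₂ + s₂ ≠ a) (h2b : s₂ + s₂ ≠ b)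
    (h3a : s₃ + s₃ ≠ a) (h3b : s₃ + s₃ ≠ b) :
    ∃ f₁ f₂ f₃ f : G, IsBasis n f₁ f₂ f₃ ∧ FormS2 n f₁ f₂ f₃ (translate (-f) S) := by
  classical
  have hab := h.ne hn
  have t1 : r - s₁ + (r - s₁) = b := by linear_combination (norm := module) h.two_r - h1
  have hcount := h.halves
  rw [h1, t1] at hcount
  have ca := congrArg (Multiset.count a) hcount
  have cb := congrArg (Multiset.count b) hcount
  simp [Multiset.count_replicate, hab, hab.symm] at ca cb
  have z3 : (r - s₁ - s₁) + (r - s₁ - s₁) = b - a := by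
    linear_combination (norm := module) t1 - h1
  obtain ⟨i, hi2, hin, y1⟩ := h.exists_nsmul hn hK h1 h3a h3b z3
  obtain ⟨j, hj2, hjn, z1⟩ := h.exists_nsmul hn hK h1 h2a h2b z3
  have htwo := EightGroup.two_eq_zero
  have hind : IndepTriple (π (s₂ - s₁)) (π (s₃ - s₁)) (π (r - s₁ - s₁)) := by
    convert h.indep using 1
    · rw [map_sub]; linear_combination -(π s₁) * htwo
    · rw [map_sub]; linear_combination -(π s₁) * htwo
    · rw [map_sub, map_sub]; linear_combination -(π s₁) * htwo
  have hind' := ((hind.sub_nsmul i).symm.sub_nsmul j)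
  have hS : translate (-s₁) S = Multiset.replicate (2 * n - 1) 0
      + Multiset.replicate (2 * n - 1) (r - s₁ - s₁)
      + {(j : ℤ) • (r - s₁ - s₁) + (s₂ - s₁ - j • (r - s₁ - s₁))}
      + {(1 - (j : ℤ)) • (r - s₁ - s₁) + (s₂ - s₁ - j • (r - s₁ - s₁))}
      + {(i : ℤ) • (r - s₁ - s₁) + (s₃ - s₁ - i • (r - s₁ - s₁))}
      + {(1 - (i : ℤ)) • (r - s₁ - s₁) + (s₃ - s₁ - i • (r - s₁ - s₁))} := by
    rw [h.eq]
    simp only [translate_add, translate_replicate]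
    rw [show 2 * m₁ + 1 = 2 * n - 1 by omega, show 2 * k₁ + 1 = 2 * n - 1 by omega,
      show -s₁ + s₁ = 0 by abel, show -s₁ + (r - s₁) = r - s₁ - s₁ by abel,
      show -s₁ + s₂ = (j : ℤ) • (r - s₁ - s₁) + (s₂ - s₁ - j • (r - s₁ - s₁)) by module,
      show -s₁ + s₃ = (i : ℤ) • (r - s₁ - s₁) + (s₃ - s₁ - i • (r - s₁ - s₁)) by module,
      show -s₁ + (r - s₂) = (1 - (j : ℤ)) • (r - s₁ - s₁) + (s₂ - s₁ - j • (r - s₁ - s₁)) by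
        linear_combination (norm := module) -z1,
      show -s₁ + (r - s₃) = (1 - (i : ℤ)) • (r - s₁ - s₁) + (s₃ - s₁ - i • (r - s₁ - s₁)) by
        linear_combination (norm := module) -y1]
    simp only [mul_zero, zero_add, Multiset.replicate_one]
    abel
  -- The form demands `b ≤ a`; interchanging `f₁` and `f₂` arranges this.
  rcases le_total i j with hij | hij
  · exact ⟨_, _, _, s₁, isBasis_of_indepTriple hn hK y1 z1 (by rw [z3]; exact h.order) hind',
      j, i, by omega, by omega, by omega, by omega, by omega, hS⟩
  · refine ⟨_, _, _, s₁, isBasis_of_indepTriple hn hK z1 y1 (by rw [z3]; exact h.order) hind'.symm,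
      i, j, by omega, by omega, by omega, by omega, by omega, ?_⟩
    rw [hS]
    abel

theorem Blocks.exists_form (hn : 2 ≤ n) (hK : Nat.card π.ker = n)
    (h : Blocks π n S a b r s₁ s₂ s₃ m₁ k₁ m₂ k₂ m₃ k₃) :
    ∃ f₁ f₂ f₃ f : G, IsBasis n f₁ f₂ f₃ ∧ (FormS1 n f₁ f₂ f₃ (translate (-f) S) ∨
      FormS2 n f₁ f₂ f₃ (translate (-f) S) ∨ FormS3 n f₁ f₂ f₃ (translate (-f) S)) := by
  classical
  obtain ⟨u₁, i₁, j₁, h, c1⟩ := h.normalize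
  obtain ⟨u₂, i₂, j₂, h, c2⟩ := h.rotate.normalize
  obtain ⟨u₃, i₃, j₃, h, c3⟩ := h.rotate.normalize
  replace h := h.rotate
  have one : ∀ {S : Multiset G}, (∃ f₁ f₂ f₃ f : G, IsBasis n f₁ f₂ f₃ ∧
      FormS1 n f₁ f₂ f₃ (translate (-f) S)) → ∃ f₁ f₂ f₃ f : G, IsBasis n f₁ f₂ f₃ ∧
      (FormS1 n f₁ f₂ f₃ (translate (-f) S) ∨ FormS2 n f₁ f₂ f₃ (translate (-f) S) ∨
        FormS3 n f₁ f₂ f₃ (translate (-f) S)) := by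
    rintro S ⟨f₁, f₂, f₃, f, hb, hf⟩
    exact ⟨f₁, f₂, f₃, f, hb, Or.inl hf⟩
  have two : ∀ {S : Multiset G}, (∃ f₁ f₂ f₃ f : G, IsBasis n f₁ f₂ f₃ ∧
      FormS2 n f₁ f₂ f₃ (translate (-f) S)) → ∃ f₁ f₂ f₃ f : G, IsBasis n f₁ f₂ f₃ ∧
      (FormS1 n f₁ f₂ f₃ (translate (-f) S) ∨ FormS2 n f₁ f₂ f₃ (translate (-f) S) ∨
        FormS3 n f₁ f₂ f₃ (translate (-f) S)) := by
    rintro S ⟨f₁, f₂, f₃, f, hb, hf⟩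
    exact ⟨f₁, f₂, f₃, f, hb, Or.inr (Or.inl hf)⟩
  rcases c1 with c1 | ⟨c1, d1, rfl, rfl⟩ <;> rcases c2 with c2 | ⟨c2, d2, rfl, rfl⟩ <;>
    rcases c3 with c3 | ⟨c3, d3, rfl, rfl⟩
  · obtain ⟨f₁, f₂, f₃, f, hb, hf⟩ := h.formS3 hn hK c1 c2 c3
    exact ⟨f₁, f₂, f₃, f, hb, Or.inr (Or.inr hf)⟩
  · exact one (h.formS1 hn hK c1 c2 c3 d3)
  · exact one (h.rotate.rotate.formS1 hn hK c3 c1 c2 d2)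
  · exact two (h.formS2 hn hK c1 c2 d2 c3 d3)
  · exact one (h.rotate.formS1 hn hK c2 c3 c1 d1)
  · exact two (h.rotate.formS2 hn hK c2 c3 d3 c1 d1)
  · exact two (h.rotate.rotate.formS2 hn hK c3 c1 d1 c2 d2)
  -- If no couple had doubles `a, b`, all halves would be empty, but they have `2n - 2 > 0` terms in
  -- total.
  · have := congrArg (Multiset.card) h.halves
    simp at this
    omega

/-- Every sequence of length `4n + 2` without zero-sum subsequence of length `2n` has one of the
three forms. -/
theorem exists_form_of_noZeroSum (hn : 2 ≤ n) (hK : Nat.card π.ker = n) [IsAddCyclic π.ker]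
    (hS : NoZeroSum (2 * n) S) (hSc : S.card = 4 * n + 2) :
    ∃ f₁ f₂ f₃ f : G, IsBasis n f₁ f₂ f₃ ∧ (FormS1 n f₁ f₂ f₃ (translate (-f) S) ∨
      FormS2 n f₁ f₂ f₃ (translate (-f) S) ∨ FormS3 n f₁ f₂ f₃ (translate (-f) S)) := by
  obtain ⟨s₁, t₁, s₂, t₂, s₃, t₃, d, M, a, b, hnd, hd1, hd2, hd3, hr2, hr3, -, hSM, hM, ha, hb,
    hab, hr, hT⟩ := exists_structure hn hK hS hSc
  obtain ⟨m₁, k₁, m₂, k₂, m₃, k₃, rfl⟩ := exists_replicate_of_mem _ _ _ _ _ _ M hM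
  obtain ⟨r, hrdef⟩ : ∃ r, r = s₁ + t₁ := ⟨_, rfl⟩
  obtain rfl : t₁ = r - s₁ := by rw [hrdef]; abel
  rw [← hrdef] at hr hr2 hr3
  obtain rfl : t₂ = r - s₂ := by rw [hr2]; abel
  obtain rfl : t₃ = r - s₃ := by rw [hr3]; abel
  have h2 := EightGroup.two_eq_zero
  refine Blocks.exists_form (π := π) (a := a) (b := b) (r := r) (s₁ := s₁) (s₂ := s₂) (s₃ := s₃)
    (m₁ := m₁) (k₁ := k₁) (m₂ := m₂) (k₂ := k₂) (m₃ := m₃) (k₃ := k₃) hn hK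
    ⟨?_, ?_, ha, hb, hab, hr, ?_⟩
  · have hrep : ∀ (m : ℕ) (y : G), Multiset.replicate (2 * m + 1) y
        = Multiset.replicate m y + Multiset.replicate m y + {y} := fun m y => by
      rw [two_mul, Multiset.replicate_add, Multiset.replicate_add, Multiset.replicate_one]
    rw [hSM]
    simp only [hrep]
    abel
  · have hdr : π r = d := by
      rw [map_sub] at hd1
      linear_combination hd1 + π s₁ * h2
    simp only [Multiset.map_add, Multiset.map_singleton, hd1, hd2, hd3,
      ← hdr, add_assoc] at hnd
    simp only [Multiset.singleton_add, Multiset.nodup_cons, Multiset.mem_cons,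
      Multiset.mem_singleton, not_or] at hnd
    obtain ⟨⟨n1, n2, n3, n4, n5⟩, -, ⟨n6, n7, n8⟩, -⟩ := hnd
    refine ⟨?_, ?_, ?_, ?_, ?_, ?_, ?_⟩ <;> intro h
    · exact n2 (by linear_combination h - π s₂ * h2)
    · exact n4 (by linear_combination h - π s₃ * h2)
    · exact n1 (by linear_combination -h)
    · exact n7 (by linear_combination h - (π s₁ + π s₃) * h2)
    · exact n3 (by linear_combination h - (π s₂ + π r) * h2)
    · exact n5 (by linear_combination h - (π s₃ + π r) * h2)
    · exact n8 (by linear_combination h - (π s₁ + π s₃ + π r) * h2)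
  · rw [← hT]
    simp only [Multiset.map_add, Multiset.map_replicate]

end Classification

/-! ### The three forms have no zero-sum subsequence of length `2n`. -/

section Converse

variable {G : Type*} [AddCommGroup G] {n : ℕ} {f₁ f₂ f₃ : G}

theorem IsBasis.dvd (h : IsBasis n f₁ f₂ f₃) {i j k : ℤ} (hs : i • f₁ + j • f₂ + k • f₃ = 0) :
    2 ∣ i ∧ 2 ∣ j ∧ (2 * n : ℤ) ∣ k := by
  obtain ⟨h1, h2, h3⟩ := h.1 i j k hs
  obtain ⟨-, -, o1, o2, o3⟩ := h
  have e1 := addOrderOf_dvd_iff_zsmul_eq_zero.2 h1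
  have e2 := addOrderOf_dvd_iff_zsmul_eq_zero.2 h2
  have e3 := addOrderOf_dvd_iff_zsmul_eq_zero.2 h3
  rw [o1] at e1
  rw [o2] at e2
  rw [o3] at e3
  exact ⟨by exact_mod_cast e1, by exact_mod_cast e2, by exact_mod_cast e3⟩

theorem exists_add_of_le_add {B : Type*} {Z S T : Multiset B} (h : Z ≤ S + T) :
    ∃ X ≤ S, ∃ Y ≤ T, Z = X + Y := by
  classical
  refine ⟨Z ∩ S, Multiset.inter_le_right, Z - S, tsub_le_iff_left.2 h, ?_⟩
  rw [add_comm, Multiset.sub_add_inter]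

theorem exists_replicate_of_le {B : Type*} {Z : Multiset B} {m : ℕ} {x : B}
    (h : Z ≤ Multiset.replicate m x) : ∃ i ≤ m, Z = Multiset.replicate i x :=
  Multiset.le_replicate_iff.1 h

theorem sum_map_const_add (f : G) (T : Multiset G) :
    (T.map fun d => f + d).sum = T.card • f + T.sum := by
  rw [Multiset.sum_map_add, Multiset.map_const', Multiset.sum_replicate, Multiset.map_id']

theorem eq_zero_of_dvd_of_lt {k : ℤ} (h : (2 * n : ℤ) ∣ k) (h0 : 0 ≤ k) (hk : k < 2 * n) :
    k = 0 := Int.eq_zero_of_dvd_of_nonneg_of_lt h0 hk h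

theorem eq_zero_or_of_dvd {k : ℤ} (hn : 2 ≤ n) (h : (2 * n : ℤ) ∣ k) (h0 : 0 ≤ k)
    (hk : k ≤ 2 * n + 1) : k = 0 ∨ k = 2 * n := by
  by_cases hlt : k < 2 * n
  · exact Or.inl (eq_zero_of_dvd_of_lt h h0 hlt)
  · have := eq_zero_of_dvd_of_lt (dvd_sub_self_right.2 h) (by omega) (by omega)
    right; omega

/-- The `f₁`-coordinate forces both or neither of the two special terms. With both, the
`f₃`-coordinate lies strictly between `0` and `2n`. With neither, it is `0` or `2n`, so one of the
blocks `0, f₂` or `f₃, f₃ + f₂` is used completely, and the `f₂`-coordinate is odd. -/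
theorem FormS1.noZeroSum (hn : 2 ≤ n) (hb : IsBasis n f₁ f₂ f₃) {T : Multiset G}
    (h : FormS1 n f₁ f₂ f₃ T) : NoZeroSum (2 * n) T := by
  obtain ⟨α, β, a, hα, hβ, -, -, rfl⟩ := h
  intro Z hZ hc hs
  simp only [← Multiset.replicate_one] at hZ
  obtain ⟨Z₅, z₅, Y₆, h₆, rfl⟩ := exists_add_of_le_add hZ
  obtain ⟨Z₄, z₄, Y₅, h₅, rfl⟩ := exists_add_of_le_add z₅
  obtain ⟨Z₃, z₃, Y₄, h₄, rfl⟩ := exists_add_of_le_add z₄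
  obtain ⟨Z₂, z₂, Y₃, h₃, rfl⟩ := exists_add_of_le_add z₃
  obtain ⟨Y₁, h₁, Y₂, h₂, rfl⟩ := exists_add_of_le_add z₂
  obtain ⟨i₁, l₁, rfl⟩ := exists_replicate_of_le h₁
  obtain ⟨i₂, l₂, rfl⟩ := exists_replicate_of_le h₂
  obtain ⟨i₃, l₃, rfl⟩ := exists_replicate_of_le h₃
  obtain ⟨i₄, l₄, rfl⟩ := exists_replicate_of_le h₄
  obtain ⟨i₅, l₅, rfl⟩ := exists_replicate_of_le h₅
  obtain ⟨i₆, l₆, rfl⟩ := exists_replicate_of_le h₆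
  simp only [Multiset.card_add, Multiset.card_replicate] at hc
  simp only [Multiset.sum_add, Multiset.sum_replicate] at hs
  have hs' : ((i₅ : ℤ) + i₆) • f₁ + ((i₂ : ℤ) + i₄ + i₆) • f₂
      + ((i₃ : ℤ) + i₄ + i₅ * a + i₆ * (1 - a)) • f₃ = 0 := by
    rw [← hs]; module
  obtain ⟨d1, d2, d3⟩ := hb.dvd hs'
  rcases (by omega : (i₅ = 0 ∧ i₆ = 0) ∨ (i₅ = 1 ∧ i₆ = 1)) with ⟨rfl, rfl⟩ | ⟨rfl, rfl⟩
  · have d3' : (2 * n : ℤ) ∣ (i₃ : ℤ) + i₄ := by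
      convert d3 using 1; push_cast; ring
    rcases eq_zero_or_of_dvd hn d3' (by omega) (by omega) with h | h <;> omega
  · have d3' : (2 * n : ℤ) ∣ (i₃ : ℤ) + i₄ + 1 := by
      convert d3 using 1; push_cast; ring
    have := eq_zero_of_dvd_of_lt d3' (by omega) (by omega)
    omega

/-- The special terms occur in couples, each contributing `f₃` for two terms. So the `f₃`-coordinate
is below `2n`, hence zero, and `2n` copies of `0` would be needed. -/
theorem FormS2.noZeroSum (hn : 2 ≤ n) (hb : IsBasis n f₁ f₂ f₃) {T : Multiset G}
    (h : FormS2 n f₁ f₂ f₃ T) : NoZeroSum (2 * n) T := by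
  obtain ⟨a, b, -, -, -, -, -, rfl⟩ := h
  intro Z hZ hc hs
  simp only [← Multiset.replicate_one] at hZ
  obtain ⟨Z₅, z₅, Y₆, h₆, rfl⟩ := exists_add_of_le_add hZ
  obtain ⟨Z₄, z₄, Y₅, h₅, rfl⟩ := exists_add_of_le_add z₅
  obtain ⟨Z₃, z₃, Y₄, h₄, rfl⟩ := exists_add_of_le_add z₄
  obtain ⟨Z₂, z₂, Y₃, h₃, rfl⟩ := exists_add_of_le_add z₃
  obtain ⟨Y₁, h₁, Y₂, h₂, rfl⟩ := exists_add_of_le_add z₂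
  obtain ⟨i₁, l₁, rfl⟩ := exists_replicate_of_le h₁
  obtain ⟨i₂, l₂, rfl⟩ := exists_replicate_of_le h₂
  obtain ⟨i₃, l₃, rfl⟩ := exists_replicate_of_le h₃
  obtain ⟨i₄, l₄, rfl⟩ := exists_replicate_of_le h₄
  obtain ⟨i₅, l₅, rfl⟩ := exists_replicate_of_le h₅
  obtain ⟨i₆, l₆, rfl⟩ := exists_replicate_of_le h₆
  simp only [Multiset.card_add, Multiset.card_replicate] at hc
  simp only [Multiset.sum_add, Multiset.sum_replicate] at hs
  have hs' : ((i₅ : ℤ) + i₆) • f₁ + ((i₃ : ℤ) + i₄) • f₂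
      + ((i₂ : ℤ) + i₃ * a + i₄ * (1 - a) + i₅ * b + i₆ * (1 - b)) • f₃ = 0 := by
    rw [← hs]; module
  obtain ⟨d1, d2, d3⟩ := hb.dvd hs'
  have d3' : (2 * n : ℤ) ∣ (i₂ : ℤ) + i₃ + i₅ := by
    obtain rfl : i₃ = i₄ := by omega
    obtain rfl : i₅ = i₆ := by omega
    convert d3 using 1; ring
  have := eq_zero_of_dvd_of_lt d3' (by omega) (by omega)
  omega

/-- The number of terms `f₃ + dᵢ` used is `0` or `2n`. If it is `0`, all three remaining
multiplicities are even, thus at most `2α + 2β + 2γ = 2n - 2` in total. If it is `2n`, exactly one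
`d` is omitted, and the rest having sum zero means `σ(D) = d`. -/
theorem FormS3.noZeroSum (hn : 2 ≤ n) (hb : IsBasis n f₁ f₂ f₃) {T : Multiset G}
    (h : FormS3 n f₁ f₂ f₃ T) : NoZeroSum (2 * n) T := by
  obtain ⟨α, β, γ, D, hα, hβ, hγ, hsum, hDc, hD, hDs, rfl⟩ := h
  intro Z hZ hc hs
  obtain ⟨Z₃, z₃, Y₄, h₄, rfl⟩ := exists_add_of_le_add hZ
  obtain ⟨Z₂, z₂, Y₃, h₃, rfl⟩ := exists_add_of_le_add z₃
  obtain ⟨Y₁, h₁, Y₂, h₂, rfl⟩ := exists_add_of_le_add z₂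
  obtain ⟨i₁, l₁, rfl⟩ := exists_replicate_of_le h₁
  obtain ⟨i₂, l₂, rfl⟩ := exists_replicate_of_le h₂
  obtain ⟨i₃, l₃, rfl⟩ := exists_replicate_of_le h₃
  obtain ⟨E, hE, rfl⟩ := exists_le_map_eq _ _ _ h₄
  have hEc := Multiset.card_le_card hE
  have hEs : E.sum ∈ AddSubgroup.closure {f₁, f₂} :=
    AddSubgroup.multiset_sum_mem _ _ fun d hd => hD d (Multiset.mem_of_le hE hd)
  obtain ⟨x, y, hxy⟩ := AddSubgroup.mem_closure_pair.1 hEs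
  simp only [Multiset.card_add, Multiset.card_replicate, Multiset.card_map] at hc
  simp only [Multiset.sum_add, Multiset.sum_replicate, sum_map_const_add] at hs
  have hs' : ((i₂ : ℤ) + x) • f₁ + ((i₃ : ℤ) + y) • f₂ + (E.card : ℤ) • f₃ = 0 := by
    rw [← hs, ← hxy]; module
  obtain ⟨d1, d2, d3⟩ := hb.dvd hs'
  rcases eq_zero_or_of_dvd hn d3 (by omega) (by omega) with h | h
  · have hE0 : E = 0 := Multiset.card_eq_zero.1 (by omega)
    subst hE0
    rw [Multiset.sum_zero] at hxy
    obtain ⟨d1', d2', -⟩ := hb.dvd (i := x) (j := y) (k := 0) (by rw [hxy]; simp)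
    rw [Multiset.card_zero] at hc
    omega
  · obtain ⟨F, rfl⟩ := Multiset.le_iff_exists_add.1 hE
    rw [Multiset.card_add] at hDc
    obtain ⟨d, rfl⟩ := Multiset.card_eq_one.1 (by omega : F.card = 1)
    obtain rfl : i₁ = 0 := by omega
    obtain rfl : i₂ = 0 := by omega
    obtain rfl : i₃ = 0 := by omega
    have hf : E.card • f₃ = 0 := by
      rw [show E.card = 2 * n by omega, ← hb.2.2.2.2, addOrderOf_nsmul_eq_zero]
    have hE0 : E.sum = 0 := by simpa [hf] using hs
    exact hDs (by simp [hE0])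

end Converse

/-! ### Reduction modulo two and the main theorem. -/

section Main

variable {G : Type*} [AddCommGroup G] {n : ℕ}

theorem NoZeroSum.of_translate {ℓ : ℕ} (hexp : ∀ g : G, ℓ • g = 0) {f : G} {S : Multiset G}
    (h : NoZeroSum ℓ (translate f S)) : NoZeroSum ℓ S := by
  intro Z hZ hc hs
  refine h (translate f Z) (Multiset.map_le_map hZ) (by simpa [translate] using hc) ?_
  rw [translate, sum_map_const_add, hs, hc, hexp, add_zero]

theorem zero_notMem_subsums_iff {ℓ : ℕ} (hℓ : ℓ ≠ 0) (S : Multiset G) :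
    (0 : G) ∉ subsums {ℓ} S ↔ NoZeroSum ℓ S := by
  constructor
  · intro h Z hZ hc hs
    refine h ⟨Z, hZ, ?_, hc, hs⟩
    rintro rfl
    exact hℓ (by simpa using hc.symm)
  · rintro h ⟨Z, hZ, -, hc, hs⟩
    exact h Z hZ hc hs

/-- The reduction modulo `2`. -/
def reduction (n : ℕ) : ZMod 2 × ZMod 2 × ZMod (2 * n) →+ EightGroup :=
  (AddMonoidHom.id (ZMod 2)).prodMap ((AddMonoidHom.id (ZMod 2)).prodMap
    (ZMod.castHom (dvd_mul_right 2 n) (ZMod 2)).toAddMonoidHom)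

theorem reduction_apply (x y : ZMod 2) (z : ZMod (2 * n)) :
    reduction n (x, y, z) = (x, y, ZMod.castHom (dvd_mul_right 2 n) (ZMod 2) z) := rfl

theorem addOrderOf_two (hn : 2 ≤ n) :
    addOrderOf ((0, 0, 2) : ZMod 2 × ZMod 2 × ZMod (2 * n)) = n := by
  rw [addOrderOf_eq_iff (by omega)]
  refine ⟨?_, ?_⟩
  · have : (n : ZMod (2 * n)) * 2 = 0 := by
      have := ZMod.natCast_self (2 * n)
      rw [← this]; push_cast; ring
    simp [this]
  · intro m hm hm0 h
    have h1 : ((m * 2 : ℕ) : ZMod (2 * n)) = 0 := by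
      have := congrArg (fun x => x.2.2) h
      simpa using this
    rw [ZMod.natCast_eq_zero_iff] at h1
    have := Nat.le_of_dvd (by omega) h1
    omega

theorem ker_reduction (hn : 2 ≤ n) :
    (reduction n).ker = AddSubgroup.zmultiples (0, 0, 2) := by
  have : NeZero (2 * n) := ⟨by omega⟩
  apply le_antisymm
  · rintro ⟨x, y, z⟩ h
    rw [AddMonoidHom.mem_ker, reduction_apply] at h
    simp only [Prod.mk_eq_zero] at h
    obtain ⟨rfl, rfl, hz⟩ := h
    obtain ⟨k, rfl⟩ := ZMod.natCast_zmod_surjective z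
    rw [map_natCast, ZMod.natCast_eq_zero_iff] at hz
    obtain ⟨j, rfl⟩ := hz
    refine AddSubgroup.mem_zmultiples_iff.2 ⟨j, ?_⟩
    simp [mul_comm]
  · rw [AddSubgroup.zmultiples_le, AddMonoidHom.mem_ker, reduction_apply]
    have : (2 : ZMod 2) = 0 := rfl
    exact Prod.ext rfl (Prod.ext rfl ((map_ofNat _ 2).trans this))

theorem exponent_eq (e : G ≃+ ZMod 2 × ZMod 2 × ZMod (2 * n)) :
    AddMonoid.exponent G = 2 * n := by
  rw [AddMonoid.exponent_eq_of_addEquiv e, AddMonoid.exponent_prod, AddMonoid.exponent_prod,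
    ZMod.exponent, ZMod.exponent]
  have : Nat.lcm 2 (2 * n) = 2 * n := Nat.lcm_eq_right (dvd_mul_right 2 n)
  change Nat.lcm 2 (Nat.lcm 2 (2 * n)) = 2 * n
  rw [this, this]

end Main

end EGZ

theorem theorem5p1 {G : Type*} [AddCommGroup G] (n : ℕ) (hn : 2 ≤ n)
    (hG : Nonempty (G ≃+ ZMod 2 × ZMod 2 × ZMod (2 * n))) :
    EGZ.egzConstant G = ((4 * n + 3 : ℕ) : ℕ∞) ∧
    ∀ S : Multiset G, S.card = 4 * n + 2 →
      ((0 : G) ∉ EGZ.subsums {AddMonoid.exponent G} S ↔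
        ∃ f₁ f₂ f₃ f : G, EGZ.IsBasis n f₁ f₂ f₃ ∧
          (EGZ.FormS1 n f₁ f₂ f₃ (EGZ.translate (-f) S) ∨
            EGZ.FormS2 n f₁ f₂ f₃ (EGZ.translate (-f) S) ∨
            EGZ.FormS3 n f₁ f₂ f₃ (EGZ.translate (-f) S))) := by
  obtain ⟨e⟩ := hG
  have hexp := EGZ.exponent_eq e
  have hexp0 : ∀ g : G, (2 * n) • g = 0 := fun g => by
    rw [← hexp]; exact AddMonoid.exponent_nsmul_eq_zero g
  -- reduction of `G` modulo `2G`
  let π : G →+ EGZ.EightGroup := (EGZ.reduction n).comp e.toAddMonoidHom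
  have hgen : addOrderOf (e.symm (0, 0, 2)) = n :=
    (addOrderOf_injective e.symm.toAddMonoidHom e.symm.injective _).trans
      (EGZ.addOrderOf_two hn)
  have hker : π.ker = AddSubgroup.zmultiples (e.symm (0, 0, 2)) := by
    ext g
    have h1 : g ∈ π.ker ↔ e g ∈ (EGZ.reduction n).ker := Iff.rfl
    rw [h1, EGZ.ker_reduction hn, AddSubgroup.mem_zmultiples_iff, AddSubgroup.mem_zmultiples_iff]
    simp only [← map_zsmul, AddEquiv.symm_apply_eq]
  have hK : Nat.card π.ker = n := by rw [hker, Nat.card_zmultiples, hgen]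
  have : IsAddCyclic π.ker := by rw [hker]; infer_instance
  have hforms : ∀ S : Multiset G, (∃ f₁ f₂ f₃ f : G, EGZ.IsBasis n f₁ f₂ f₃ ∧
      (EGZ.FormS1 n f₁ f₂ f₃ (EGZ.translate (-f) S) ∨
        EGZ.FormS2 n f₁ f₂ f₃ (EGZ.translate (-f) S) ∨
        EGZ.FormS3 n f₁ f₂ f₃ (EGZ.translate (-f) S))) → EGZ.NoZeroSum (2 * n) S := by
    rintro S ⟨f₁, f₂, f₃, f, hb, h | h | h⟩
    · exact (h.noZeroSum hn hb).of_translate hexp0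
    · exact (h.noZeroSum hn hb).of_translate hexp0
    · exact (h.noZeroSum hn hb).of_translate hexp0
  have hiff := fun S : Multiset G => EGZ.zero_notMem_subsums_iff (by omega : 2 * n ≠ 0) S
  refine ⟨?_, fun S hS => ?_⟩
  · rw [EGZ.egzConstant, EGZ.zeroSumConstant, hexp]
    apply le_antisymm
    · refine sInf_le ⟨4 * n + 3, fun S hS => ?_, rfl⟩
      by_contra hno
      obtain ⟨T, hT, hTc⟩ := EGZ.exists_le_card_eq hS
      exact EGZ.card_ne_of_noZeroSum hn hK
        (fun Z hZ => (hiff S).1 hno Z (hZ.trans hT)) hTc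
    · refine le_sInf ?_
      rintro _ ⟨ℓ, hℓ, rfl⟩
      by_contra hlt
      have hlt' : ℓ < 4 * n + 3 := Nat.cast_lt.1 (not_le.1 hlt)
      -- a sequence of length `4n + 2` of the third form
      obtain ⟨f₁, hf₁⟩ : ∃ f₁ : G, f₁ = e.symm (1, 0, 0) := ⟨_, rfl⟩
      obtain ⟨f₂, hf₂⟩ : ∃ f₂ : G, f₂ = e.symm (0, 1, 0) := ⟨_, rfl⟩
      obtain ⟨f₃, hf₃⟩ : ∃ f₃ : G, f₃ = e.symm (0, 0, 1) := ⟨_, rfl⟩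
      have hπ : ∀ x, π (e.symm x) = EGZ.reduction n x := fun x =>
        congrArg (EGZ.reduction n) (e.apply_symm_apply x)
      have h11 : (1 : ZMod 2) + 1 = 0 := rfl
      have hind : EGZ.IndepTriple (π f₁) (π f₂) (π f₃) := by
        rw [hf₁, hf₂, hf₃, hπ, hπ, hπ]
        simp only [EGZ.reduction_apply, map_zero, map_one]
        decide
      have hb : EGZ.IsBasis n f₁ f₂ f₃ := by
        refine EGZ.isBasis_of_indepTriple hn hK ?_ ?_ ?_ hind
        · rw [hf₁, ← map_add]; simp [h11]
        · rw [hf₂, ← map_add]; simp [h11]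
        · rw [hf₃, ← map_add]
          refine Eq.trans (congrArg (fun x => addOrderOf (e.symm x)) ?_) hgen
          exact Prod.ext (add_zero 0) (Prod.ext (add_zero 0) one_add_one_eq_two)
      -- The form (s3) with `α = n - 1`, `β = γ = 0` and `D = 0^(2n-1) f₁ f₂`, whose sum `f₁ + f₂`
      -- is not a term.
      set S : Multiset G := Multiset.replicate (2 * (n - 1) + 1) 0
        + Multiset.replicate (2 * 0 + 1) f₁ + Multiset.replicate (2 * 0 + 1) f₂
        + (Multiset.replicate (2 * n - 1) 0 + {f₁} + {f₂}).map (fun d => f₃ + d) with hS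
      have hform : EGZ.FormS3 n f₁ f₂ f₃ S := by
        refine ⟨n - 1, 0, 0, Multiset.replicate (2 * n - 1) 0 + {f₁} + {f₂}, le_rfl, by omega,
          by omega, by omega, ?_, ?_, ?_, hS⟩
        · simp; omega
        · intro d hd
          simp only [Multiset.mem_add, Multiset.mem_replicate, Multiset.mem_singleton] at hd
          rcases hd with (⟨-, rfl⟩ | rfl) | rfl
          · exact zero_mem _
          · exact AddSubgroup.subset_closure (by simp)
          · exact AddSubgroup.subset_closure (by simp)
        · intro hd
          simp only [Multiset.sum_add, Multiset.sum_replicate, smul_zero, zero_add,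
            Multiset.sum_singleton, Multiset.mem_add, Multiset.mem_replicate,
            Multiset.mem_singleton] at hd
          obtain ⟨i1, i2, -, i12, -⟩ := hind
          rcases hd with (⟨-, hd⟩ | hd) | hd
          · exact i12 (by rw [← map_add, hd, map_zero])
          · exact i2 (by rw [show f₂ = 0 by simpa using hd, map_zero])
          · exact i1 (by rw [show f₁ = 0 by simpa using hd, map_zero])
      have hSc : S.card = 4 * n + 2 := by rw [hS]; simp; omega
      exact (hiff S).2 (hform.noZeroSum hn hb) (hℓ S (by omega))
  · rw [hexp, hiff]
    exact ⟨fun h => EGZ.exists_form_of_noZeroSum hn hK h hS, hforms S⟩
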